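/- For $n\ge 2$ let $X^n$ be the continuous-time Markov chain on the $2n+1$ vertices $A=v_0,v_1,\dots,v_n=B,\dots,v_{2n}=C$ with the following jump rates (all others are $0$), where $\varepsilon_n:=2^{-n^2}$ and $\varepsilon_n':=(n-1)2^{-n^3}$: $v_i\to v_{i+1}$ at rate $1$ for $0\le i<2n$, $i\neq n$; $B=v_n\to v_{n+1}$ at rate $1/n$; $B\to C$ (along an extra edge) at rate $1-1/n$; $v_{i+1}\to v_i$ at rate $\varepsilon_n$ for $0\le i<2n$; and $C\to B$ (along the extra edge) at rate $\varepsilon_n'$. This chain is irreducible and has a unique reversible probability measure $\pi_n$. Let $P^n_t$ be its semigroup, and let $Y^n$ be the chain formed by $n$ independent copies of $X^n$, with semigroup $Q^n_t(\mathbf x,\mathbf y)=\prod_{i=1}^n P^n_t(x_i,y_i)$ and equilibrium measure $\mu_n=\pi_n^{\otimes n}$. For a finite chain with semigroup $P_t$ and equilibrium measure $\pi$ put $d(t)=\max_x\|P_t(x,\cdot)-\pi\|_{TV}$ (total-variation distance) and $d^s(t)=1-\min_{x,y}P_t(x,y)/\pi(y)$ (separation distance). The mixing time at level $a\in(0,1)$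 is $\inf\{t\ge0: d(t)<a\}$, respectively $\inf\{t\ge 0: d^s(t)<a\}$; a sequence of chains with mixing times $t^n(a)$ has cutoff if $\lim_{n\to\infty} t^n(\varepsilon)/t^n(1-\varepsilon)=1$ for every $\varepsilon\in(0,1/2]$. Then, both for the total-variation distance and for the separation distance: (i) the sequence $X^n$ has cutoff around time $n$: it has cutoff, and its mixing times satisfy $\lim_{n\to\infty}t^n(a)/n=1$ for every $a\in(0,1)$; (ii) the sequence $Y^n$ does not have cutoff: its mixing times $T^n(a)$ satisfy $$\lim_{n\to\infty}\frac{T^n(a)}{n}=\begin{cases}2 & \text{for every } a\in(0,1-e^{-1}),\\ 1 & \text{for every } a\in(1-e^{-1},1).\end{cases}$$ In particular $\lim_{n\to\infty}T^n(\varepsilon)/T^n(1-\varepsilon)=2$ for every $\varepsilon\in(0,e^{-1})$, so no constant smaller than $2$ can bound the limsup of this ratio for all sequences of product chains. -/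

import Mathlib

open Filter Topology

noncomputable section

namespace ProductCutoff

/-! ### Finite continuous-time Markov chains -/

section General

variable {Ω : Type*} [Fintype Ω]

/-- The generator of the chain with jump rates `q` (the diagonal values of `q` play no role). -/
def generator [DecidableEq Ω] (q : Ω → Ω → ℝ) : Matrix Ω Ω ℝ :=
  fun x y => if x = y then -∑ z ∈ Finset.univ.erase x, q x z else q x y

/-- The Markov semigroup `P_t = exp (t L)`. -/
def semigroup [DecidableEq Ω] (q : Ω → Ω → ℝ) (t : ℝ) : Matrix Ω Ω ℝ :=
  NormedSpace.exp (t • generator q)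

/-- `π` is a probability on `Ω` in detailed balance with the jump rates `q`. -/
def IsReversibleProb (q : Ω → Ω → ℝ) (π : Ω → ℝ) : Prop :=
  (∀ x, 0 ≤ π x) ∧ ∑ x, π x = 1 ∧ ∀ x y, π x * q x y = π y * q y x

/-- Every state can be reached from every state through jumps of positive rate. -/
def IsIrreducible (q : Ω → Ω → ℝ) : Prop :=
  ∀ x y, Relation.ReflTransGen (fun u v => u ≠ v ∧ 0 < q u v) x y

/-- Maximal total-variation distance to `π` at time `t`, for transition probabilities `P`. -/
def tvDist (P : ℝ → Matrix Ω Ω ℝ) (π : Ω → ℝ) (t : ℝ) : ℝ :=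
  ⨆ x, (1 / 2) * ∑ y, |P t x y - π y|

/-- Maximal separation distance to `π` at time `t`, for transition probabilities `P`. -/
def sepDist (P : ℝ → Matrix Ω Ω ℝ) (π : Ω → ℝ) (t : ℝ) : ℝ :=
  1 - ⨅ p : Ω × Ω, P t p.1 p.2 / π p.2

/-- Transition probabilities of `k` independent copies of a chain. -/
def prodSemigroup (k : ℕ) (P : ℝ → Matrix Ω Ω ℝ) (t : ℝ) : Matrix (Fin k → Ω) (Fin k → Ω) ℝ :=
  fun x y => ∏ i, P t (x i) (y i)

/-- The product measure `π^{⊗ k}`. -/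
def prodMeasure (k : ℕ) (π : Ω → ℝ) (x : Fin k → Ω) : ℝ := ∏ i, π (x i)

end General

/-- Mixing time at level `a` for a distance to equilibrium `d`. -/
def mixingTime (d : ℝ → ℝ) (a : ℝ) : ℝ := sInf {t : ℝ | 0 ≤ t ∧ d t < a}

/-- Cutoff for a sequence of chains whose `n`-th mixing time at level `a` is `T n a`. -/
def HasCutoff (T : ℕ → ℝ → ℝ) : Prop :=
  ∀ ε : ℝ, 0 < ε → ε ≤ 1 / 2 → Tendsto (fun n => T n ε / T n (1 - ε)) atTop (𝓝 1)

/-! ### The chains `X^n` and `Y^n` -/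

/-- The vertices of the graph: `0 = A`, `n = B` and `2 n = C`, in the order of the path. -/
abbrev Vertex (n : ℕ) : Type := Fin (2 * n + 1)

/-- The backward rate along the path. -/
def backRate (n : ℕ) : ℝ := 1 / 2 ^ (n ^ 2)

/-- The rate from `C` to `B` along the extra edge. -/
def greenBackRate (n : ℕ) : ℝ := ((n : ℝ) - 1) / 2 ^ (n ^ 3)

/-- The jump rates of `X^n`: one summand for each kind of oriented edge (forward along the path,
backward along the path, extra edge from `B` to `C`, extra edge from `C` to `B`). -/
def rate (n : ℕ) (x y : Vertex n) : ℝ :=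
  (if y.val = x.val + 1 then (if x.val = n then 1 / (n : ℝ) else 1) else 0)
  + (if x.val = y.val + 1 then backRate n else 0)
  + (if x.val = n ∧ y.val = 2 * n then 1 - 1 / (n : ℝ) else 0)
  + (if x.val = 2 * n ∧ y.val = n then greenBackRate n else 0)

/-- Total-variation mixing time of `X^n`, whose equilibrium measure is `π n`. -/
def tMix (π : (n : ℕ) → Vertex n → ℝ) (n : ℕ) (a : ℝ) : ℝ :=
  mixingTime (tvDist (semigroup (rate n)) (π n)) a

/-- Separation mixing time of `X^n`. -/
def tSep (π : (n : ℕ) → Vertex n → ℝ) (n : ℕ) (a : ℝ) : ℝ :=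
  mixingTime (sepDist (semigroup (rate n)) (π n)) a

/-- Total-variation mixing time of `Y^n`, the chain of `n` independent copies of `X^n`. -/
def TMix (π : (n : ℕ) → Vertex n → ℝ) (n : ℕ) (a : ℝ) : ℝ :=
  mixingTime (tvDist (prodSemigroup n (semigroup (rate n))) (prodMeasure n (π n))) a

/-- Separation mixing time of `Y^n`. -/
def TSep (π : (n : ℕ) → Vertex n → ℝ) (n : ℕ) (a : ℝ) : ℝ :=
  mixingTime (sepDist (prodSemigroup n (semigroup (rate n))) (prodMeasure n (π n))) a

end ProductCutoff

end

namespace ProductCutoff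

/-! ### The Markov semigroup of a finite chain -/

section SemigroupTheory

variable {Ω : Type*} [Fintype Ω] [DecidableEq Ω]

open scoped Matrix Matrix.Norms.Operator

/-! The backward rates are so small that the walk essentially only moves forward and `π n` sits
almost entirely at `C`, so everything is governed by the probability of being at `C` at time `t`.
From `A`, the walk needs time about `n` to reach `B`. With probability `1 - 1/n` it then jumps to
`C` within time `O(1)`; otherwise it walks `n` further edges and arrives near time `2n`. Hence
`P_{cn}(A, C)` tends to `0` for `c < 1`, equals `1 - 1/n + o(1/n)` for `1 < c < 2`, and equals `1 -
o(1/n)` for `c > 2`. One copy does not see the defect `1/n`, so it mixes at time `n`. For `n` copies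
the `n`-th power has the three limits `0`, `e⁻¹` and `1`, so the distance stays near `1 - e⁻¹`
between times `n` and `2n`.

Lower bounds on total variation come from testing the single state "every coordinate at `C`"
(`pow_sub_pow_le_tvDist_prod`). Upper bounds are proved for separation, which dominates total
variation (`tvDist_le_sepDist`) and behaves well under products (`sepDist_prod_le`). For separation
the states `y ≠ C` are harmless: by reversibility one may assume that `x` precedes `y`, and
following the path already has probability `e^{-O(n log n)}`, far above `π(y) ≤ 2^{-n²}`
(`eventually_le_semigroup_div`).

The estimates of `P_t(x, C)` are Chernoff bounds in disguise. Functions `A e^{κs} + B + ηs` are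
compared with the semigroup by a maximum principle (`semigroup_mulVec_le_of_supersolution`): `A` is
a power `z^(number of remaining steps)`, `B` is the limiting probability of the event, and `η` pays
for all backward jumps. The errors must be `o(1/n)`, not just `o(1)`, to survive the `n`-th power.
-/

theorem hasDerivAt_semigroup (q : Ω → Ω → ℝ) (t : ℝ) :
    HasDerivAt (semigroup q) (semigroup q t * generator q) t :=
  hasDerivAt_exp_smul_const (generator q) t

theorem hasDerivAt_semigroup_apply (q : Ω → Ω → ℝ) (t : ℝ) (x y : Ω) :
    HasDerivAt (fun s => semigroup q s x y) ((semigroup q t * generator q) x y) t := by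
  have h := hasDerivAt_semigroup q t
  exact (LinearMap.toContinuousLinearMap
    (Matrix.entryLinearMap ℝ ℝ x y)).hasFDerivAt.comp_hasDerivAt t h

theorem exp_nonneg_of_entries_nonneg {M : Matrix Ω Ω ℝ} (hM : ∀ x y, 0 ≤ M x y) (x y : Ω) :
    0 ≤ NormedSpace.exp M x y := by
  have hpow : ∀ (k : ℕ) (x y : Ω), 0 ≤ (M ^ k) x y := by
    intro k
    induction k with
    | zero => intro x y; rw [pow_zero, Matrix.one_apply]; split_ifs <;> norm_num
    | succ k ih =>
      intro x y
      rw [pow_succ, Matrix.mul_apply]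
      exact Finset.sum_nonneg fun z _ => mul_nonneg (ih x z) (hM z y)
  have h := (NormedSpace.exp_series_hasSum_exp' (𝕂 := ℝ) M).mapL
    (LinearMap.toContinuousLinearMap (Matrix.entryLinearMap ℝ ℝ x y))
  refine h.nonneg fun k => ?_
  exact mul_nonneg (by positivity) (hpow k x y)

theorem semigroup_zero (q : Ω → Ω → ℝ) : semigroup q 0 = 1 := by
  simp [semigroup]

/-- Uniformisation: adding a multiple `K` of the identity makes the generator entrywise nonnegative,
and only multiplies the exponential by the scalar `e^{tK}`. -/
theorem semigroup_nonneg {q : Ω → Ω → ℝ} (hq : ∀ x y, 0 ≤ q x y) {t : ℝ} (ht : 0 ≤ t) (x y : Ω) :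
    0 ≤ semigroup q t x y := by
  set K : ℝ := ∑ u, ∑ v, q u v with hK
  have hsum : t • generator q = t • (generator q + K • 1) + (-(t * K)) • (1 : Matrix Ω Ω ℝ) := by
    rw [smul_add, smul_smul, add_assoc, ← add_smul]; simp
  have hexp : NormedSpace.exp ((-(t * K)) • (1 : Matrix Ω Ω ℝ))
      = Real.exp (-(t * K)) • (1 : Matrix Ω Ω ℝ) := by
    rw [← Matrix.diagonal_one, ← Matrix.diagonal_smul, Matrix.exp_diagonal, ← Matrix.diagonal_smul]
    congr 1
    ext i
    simp [Pi.coe_exp, Real.exp_eq_exp_ℝ]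
  have hcomm : Commute (t • (generator q + K • 1)) ((-(t * K)) • (1 : Matrix Ω Ω ℝ)) :=
    (Commute.one_right _).smul_right _
  rw [semigroup, hsum, Matrix.exp_add_of_commute _ _ hcomm, hexp, mul_smul_comm, mul_one]
  refine mul_nonneg (Real.exp_nonneg _) (exp_nonneg_of_entries_nonneg (fun u v => ?_) x y)
  refine mul_nonneg ht ?_
  rw [Matrix.add_apply, Matrix.smul_apply, Matrix.one_apply, generator]
  split_ifs with huv
  · have h1 : ∑ z ∈ Finset.univ.erase u, q u z ≤ ∑ z, q u z :=
      Finset.sum_le_sum_of_subset_of_nonneg (Finset.erase_subset _ _) fun _ _ _ => hq _ _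
    have h2 : ∑ z, q u z ≤ K :=
      Finset.single_le_sum (f := fun u => ∑ z, q u z)
        (fun _ _ => Finset.sum_nonneg fun _ _ => hq _ _) (Finset.mem_univ u)
    simp only [smul_eq_mul, mul_one]
    linarith
  · simpa using hq u v

theorem generator_mulVec (q : Ω → Ω → ℝ) (f : Ω → ℝ) (x : Ω) :
    (generator q *ᵥ f) x = ∑ y, q x y * (f y - f x) := by
  have h1 : (generator q *ᵥ f) x = ∑ y, generator q x y * f y := rfl
  rw [h1, ← Finset.add_sum_erase _ _ (Finset.mem_univ x),
    ← Finset.add_sum_erase Finset.univ (fun y => q x y * (f y - f x)) (Finset.mem_univ x)]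
  have h2 : ∑ y ∈ Finset.univ.erase x, generator q x y * f y
      = ∑ y ∈ Finset.univ.erase x, q x y * f y := by
    refine Finset.sum_congr rfl fun y hy => ?_
    rw [generator, if_neg (Finset.ne_of_mem_erase hy).symm]
  rw [h2]
  simp only [generator, if_true, mul_sub, Finset.sum_sub_distrib, ← Finset.sum_mul]
  ring

theorem semigroup_mulVec_mono {q : Ω → Ω → ℝ} (hq : ∀ x y, 0 ≤ q x y) {t : ℝ} (ht : 0 ≤ t)
    {f g : Ω → ℝ} (h : ∀ y, f y ≤ g y) (x : Ω) :
    (semigroup q t *ᵥ f) x ≤ (semigroup q t *ᵥ g) x :=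
  Finset.sum_le_sum fun y _ => mul_le_mul_of_nonneg_left (h y) (semigroup_nonneg hq ht x y)

/-- Comparison principle: a supersolution of the backward equation dominates the solution. -/
theorem semigroup_mulVec_le_of_supersolution {q : Ω → Ω → ℝ} (hq : ∀ x y, 0 ≤ q x y) {t : ℝ}
    (ht : 0 ≤ t) {f : Ω → ℝ} {w w' : ℝ → Ω → ℝ} (hf : ∀ y, f y ≤ w 0 y)
    (hw : ∀ s x, HasDerivAt (fun s => w s x) (w' s x) s)
    (hL : ∀ s, 0 ≤ s → s ≤ t → ∀ x, (generator q *ᵥ w s) x ≤ w' s x) (x : Ω) :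
    (semigroup q t *ᵥ f) x ≤ w t x := by
  -- Duhamel interpolation: `P_{t-s} w_s` runs from `P_t w_0` to `w_t`, with derivative `P_{t-s} (w'
  -- - L w) ≥ 0`.
  have hder : ∀ s, HasDerivAt (fun s => (semigroup q (t - s) *ᵥ w s) x)
      ((semigroup q (t - s) *ᵥ (w' s - generator q *ᵥ w s)) x) s := by
    intro s
    have h1 : ∀ y, HasDerivAt (fun s => semigroup q (t - s) x y * w s y)
        (-(semigroup q (t - s) * generator q) x y * w s y + semigroup q (t - s) x y * w' s y) s := by
      intro y
      have ha := (hasDerivAt_semigroup_apply q (t - s) x y).scomp s ((hasDerivAt_id s).const_sub t)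
      simp only [smul_eq_mul, neg_one_mul] at ha
      exact ha.mul (hw s y)
    have h2 := HasDerivAt.fun_sum fun y (_ : y ∈ Finset.univ) => h1 y
    refine h2.congr_deriv ?_
    rw [Matrix.mulVec_sub, Matrix.mulVec_mulVec, Pi.sub_apply, Finset.sum_add_distrib]
    simp only [neg_mul, Finset.sum_neg_distrib]
    rw [add_comm, ← sub_eq_add_neg]
    rfl
  have hmono : MonotoneOn (fun s => (semigroup q (t - s) *ᵥ w s) x) (Set.Icc 0 t) := by
    refine monotoneOn_of_deriv_nonneg (convex_Icc 0 t)
      (fun s _ => (hder s).continuousAt.continuousWithinAt)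
      (fun s _ => (hder s).differentiableAt.differentiableWithinAt) fun s hs => ?_
    rw [interior_Icc] at hs
    rw [(hder s).deriv]
    refine Finset.sum_nonneg fun y _ => mul_nonneg (semigroup_nonneg hq (by linarith [hs.2]) x y) ?_
    exact sub_nonneg.2 (hL s hs.1.le hs.2.le y)
  have h := hmono (Set.left_mem_Icc.2 ht) (Set.right_mem_Icc.2 ht) ht
  simp only [sub_zero, sub_self, semigroup_zero, Matrix.one_mulVec] at h
  exact (semigroup_mulVec_mono hq ht hf x).trans h

theorem le_semigroup_mulVec_of_subsolution {q : Ω → Ω → ℝ} (hq : ∀ x y, 0 ≤ q x y) {t : ℝ}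
    (ht : 0 ≤ t) {f : Ω → ℝ} {w w' : ℝ → Ω → ℝ} (hf : ∀ y, w 0 y ≤ f y)
    (hw : ∀ s x, HasDerivAt (fun s => w s x) (w' s x) s)
    (hL : ∀ s, 0 ≤ s → s ≤ t → ∀ x, w' s x ≤ (generator q *ᵥ w s) x) (x : Ω) :
    w t x ≤ (semigroup q t *ᵥ f) x := by
  have h := semigroup_mulVec_le_of_supersolution hq ht (f := -f) (w := fun s => -w s)
    (w' := fun s => -w' s) (fun y => neg_le_neg (hf y)) (fun s x => (hw s x).neg)
    (fun s h0 h1 x => by rw [Matrix.mulVec_neg]; exact neg_le_neg (hL s h0 h1 x)) x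
  rw [Matrix.mulVec_neg] at h
  exact neg_le_neg_iff.1 h

theorem semigroup_mulVec_one {q : Ω → Ω → ℝ} (hq : ∀ x y, 0 ≤ q x y) {t : ℝ} (ht : 0 ≤ t) (x : Ω) :
    (semigroup q t *ᵥ fun _ => 1) x = 1 := by
  have hL : ∀ x, (generator q *ᵥ fun _ => (1 : ℝ)) x = 0 := fun x => by simp [generator_mulVec]
  refine le_antisymm ?_ ?_
  · exact semigroup_mulVec_le_of_supersolution hq ht (w := fun _ _ => 1) (w' := fun _ _ => 0)
      (fun _ => le_rfl) (fun s x => hasDerivAt_const s 1) (fun s _ _ x => (hL x).le) x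
  · exact le_semigroup_mulVec_of_subsolution hq ht (w := fun _ _ => 1) (w' := fun _ _ => 0)
      (fun _ => le_rfl) (fun s x => hasDerivAt_const s 1) (fun s _ _ x => (hL x).ge) x

theorem sum_semigroup {q : Ω → Ω → ℝ} (hq : ∀ x y, 0 ≤ q x y) {t : ℝ} (ht : 0 ≤ t) (x : Ω) :
    ∑ y, semigroup q t x y = 1 := by
  simpa [Matrix.mulVec, dotProduct] using semigroup_mulVec_one hq ht x

theorem semigroup_mulVec_single (q : Ω → Ω → ℝ) (t : ℝ) (x y : Ω) :
    (semigroup q t *ᵥ fun z => if z = y then 1 else 0) x = semigroup q t x y := by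
  simp [Matrix.mulVec, dotProduct]

theorem semigroup_mulVec_compl {q : Ω → Ω → ℝ} (hq : ∀ x y, 0 ≤ q x y) {t : ℝ} (ht : 0 ≤ t)
    (x y : Ω) :
    (semigroup q t *ᵥ fun z => if z = y then 0 else 1) x = 1 - semigroup q t x y := by
  have h : (fun z => if z = y then (0 : ℝ) else 1)
      = (fun _ => 1) - fun z => if z = y then (1 : ℝ) else 0 := by
    ext z; simp only [Pi.sub_apply]; split_ifs <;> norm_num
  rw [h, Matrix.mulVec_sub, Pi.sub_apply, semigroup_mulVec_one hq ht, semigroup_mulVec_single]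

/-- Detailed balance says that conjugation by `diag π` transposes the generator; the exponential
inherits this. -/
theorem semigroup_reversible {q : Ω → Ω → ℝ} {π : Ω → ℝ} (hπ : ∀ x, 0 < π x)
    (hrev : ∀ x y, π x * q x y = π y * q y x) (t : ℝ) (x y : Ω) :
    π x * semigroup q t x y = π y * semigroup q t y x := by
  set D : Matrix Ω Ω ℝ := Matrix.diagonal π
  set E : Matrix Ω Ω ℝ := Matrix.diagonal fun x => (π x)⁻¹
  have hDE : D * E = 1 := by
    rw [Matrix.diagonal_mul_diagonal, ← Matrix.diagonal_one]
    congr 1; ext i; exact mul_inv_cancel₀ (hπ i).ne'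
  have hED : E * D = 1 := mul_eq_one_comm.1 hDE
  have hDu : IsUnit D := ⟨⟨D, E, hDE, hED⟩, rfl⟩
  have hDinv : D⁻¹ = E := Matrix.inv_eq_right_inv hDE
  have hA : D * (t • generator q) = (t • generator q)ᵀ * D := by
    ext u v
    rw [Matrix.diagonal_mul, Matrix.mul_diagonal]
    simp only [Matrix.smul_apply, Matrix.transpose_apply, smul_eq_mul, generator]
    by_cases huv : u = v
    · subst huv; simp only [if_true]; ring
    · rw [if_neg huv, if_neg (Ne.symm huv)]
      linear_combination t * hrev u v
  have h := Matrix.exp_conj D (t • generator q) hDu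
  rw [hDinv, hA, Matrix.mul_assoc, hDE, Matrix.mul_one, Matrix.exp_transpose] at h
  have h' : (semigroup q t)ᵀ * D = D * semigroup q t := by
    rw [semigroup, h, Matrix.mul_assoc, hED, Matrix.mul_one]
  have h'' := congrFun (congrFun h' x) y
  rw [Matrix.diagonal_mul, Matrix.mul_diagonal, Matrix.transpose_apply] at h''
  linarith

end SemigroupTheory

/-! ### Reversible probabilities of irreducible chains -/

section Reversible

variable {Ω : Type*} [Fintype Ω] {q : Ω → Ω → ℝ} {π π' : Ω → ℝ}

/-- By detailed balance a zero of `π` spreads backwards along edges of positive rate, hence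
everywhere. -/
theorem IsReversibleProb.pos (hirr : IsIrreducible q) (hπ : IsReversibleProb q π) (x : Ω) :
    0 < π x := by
  obtain ⟨h0, h1, hrev⟩ := hπ
  refine lt_of_le_of_ne (h0 x) fun hx => ?_
  have hzero : ∀ y, π y = 0 := by
    intro y
    induction hirr y x using Relation.ReflTransGen.head_induction_on with
    | refl => exact hx.symm
    | head huv _ ih =>
      rename_i u v _
      have h2 : π u * q u v = 0 := by rw [hrev u v, ih, zero_mul]
      exact (mul_eq_zero.1 h2).resolve_right huv.2.ne'
  simp [hzero] at h1

theorem IsReversibleProb.unique (hirr : IsIrreducible q) (hπ : IsReversibleProb q π)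
    (hπ' : IsReversibleProb q π') : π = π' := by
  have hpos := hπ.pos hirr
  have hpos' := hπ'.pos hirr
  have hcross : ∀ x y, π x * π' y = π y * π' x := by
    intro x y
    -- Both measures have the same ratio across an edge of positive rate, so `π / π'` is constant
    -- along paths.
    have hratio : π x / π' x = π y / π' y := by
      induction hirr x y using Relation.ReflTransGen.head_induction_on with
      | refl => rfl
      | head huv _ ih =>
        rename_i u v _
        rw [← ih, div_eq_div_iff (hpos' u).ne' (hpos' v).ne']
        have h1 := hπ.2.2 u v
        have h2 := hπ'.2.2 u v
        refine mul_right_cancel₀ huv.2.ne' ?_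
        linear_combination π' v * h1 - π v * h2
    rw [div_eq_div_iff (hpos' x).ne' (hpos' y).ne'] at hratio
    exact hratio
  ext x
  have h : ∑ y, π x * π' y = ∑ y, π y * π' x := Finset.sum_congr rfl fun y _ => hcross x y
  rwa [← Finset.mul_sum, ← Finset.sum_mul, hπ.2.1, hπ'.2.1, mul_one, one_mul] at h

end Reversible

/-! ### Distances to equilibrium -/

section Distances

variable {Ω : Type*} {P : ℝ → Matrix Ω Ω ℝ} {π : Ω → ℝ} {t : ℝ}

theorem sepDist_le [Nonempty Ω] {m : ℝ} (h : ∀ x y, m ≤ P t x y / π y) : sepDist P π t ≤ 1 - m := by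
  have : m ≤ ⨅ p : Ω × Ω, P t p.1 p.2 / π p.2 := le_ciInf fun p => h p.1 p.2
  unfold sepDist
  linarith

theorem prodMeasure_pos (k : ℕ) (hπ : ∀ x, 0 < π x) (x : Fin k → Ω) : 0 < prodMeasure k π x :=
  Finset.prod_pos fun _ _ => hπ _

theorem sepDist_prod_le [Nonempty Ω] (k : ℕ) {m : ℝ} (hm : 0 ≤ m)
    (h : ∀ x y, m ≤ P t x y / π y) :
    sepDist (prodSemigroup k P) (prodMeasure k π) t ≤ 1 - m ^ k := by
  refine sepDist_le fun x y => ?_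
  rw [prodSemigroup, prodMeasure, ← Finset.prod_div_distrib]
  calc m ^ k = ∏ _i : Fin k, m := by simp
    _ ≤ ∏ i, P t (x i) (y i) / π (y i) :=
      Finset.prod_le_prod (fun _ _ => hm) fun i _ => h (x i) (y i)

variable [Fintype Ω]

theorem tvDist_le_sepDist [Nonempty Ω] (hπ : ∀ x, 0 < π x) (hπ1 : ∑ x, π x = 1)
    (hP1 : ∀ x, ∑ y, P t x y = 1) : tvDist P π t ≤ sepDist P π t := by
  refine ciSup_le fun x => ?_
  have hs : ∀ y, (1 - sepDist P π t) * π y ≤ P t x y := by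
    intro y
    rw [← le_div_iff₀ (hπ y)]
    have := ciInf_le (Set.finite_range fun p : Ω × Ω => P t p.1 p.2 / π p.2).bddBelow (x, y)
    unfold sepDist
    linarith
  have hs0 : 0 ≤ sepDist P π t := by
    have h := Finset.sum_le_sum fun y (_ : y ∈ Finset.univ) => hs y
    rw [← Finset.mul_sum, hπ1, hP1] at h
    linarith
  -- Only the negative part of `P - π` needs control, and it is at most `s π` with `s` the
  -- separation; the signed terms sum to `0`.
  have habs : ∀ y, |P t x y - π y| ≤ (P t x y - π y) + 2 * (sepDist P π t * π y) := by
    intro y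
    have h1 := hs y
    have h2 := mul_nonneg hs0 (hπ y).le
    rw [abs_le]
    constructor <;> linarith
  have h := Finset.sum_le_sum fun y (_ : y ∈ Finset.univ) => habs y
  rw [Finset.sum_add_distrib, Finset.sum_sub_distrib, hP1, hπ1, ← Finset.mul_sum, ← Finset.mul_sum,
    hπ1] at h
  linarith

/-- The deficit at `y` is compensated by an equal excess over the other states; counting both
cancels the factor `1/2`. -/
theorem sub_le_tvDist (hπ1 : ∑ x, π x = 1) (hP1 : ∀ x, ∑ y, P t x y = 1) (x y : Ω) :
    π y - P t x y ≤ tvDist P π t := by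
  classical
  have h1 : (1 / 2) * ∑ y, |P t x y - π y| ≤ tvDist P π t :=
    le_ciSup (f := fun x => (1 / 2) * ∑ y, |P t x y - π y|) (Set.finite_range _).bddAbove x
  have h2 : ∑ z, (P t x z - π z) = 0 := by rw [Finset.sum_sub_distrib, hP1, hπ1, sub_self]
  rw [← Finset.add_sum_erase _ _ (Finset.mem_univ y)] at h1 h2
  have h3 : |∑ z ∈ Finset.univ.erase y, (P t x z - π z)|
      ≤ ∑ z ∈ Finset.univ.erase y, |P t x z - π z| := Finset.abs_sum_le_sum_abs _ _
  have h4 := le_abs_self (∑ z ∈ Finset.univ.erase y, (P t x z - π z))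
  have h5 := neg_le_abs (P t x y - π y)
  linarith

theorem sum_prodSemigroup (k : ℕ) (hP1 : ∀ x, ∑ y, P t x y = 1) (x : Fin k → Ω) :
    ∑ y, prodSemigroup k P t x y = 1 := by
  simp only [prodSemigroup]
  rw [← Fintype.prod_sum fun i z => P t (x i) z]
  simp [hP1]

theorem sum_prodMeasure (k : ℕ) (hπ1 : ∑ x, π x = 1) : ∑ x, prodMeasure k π x = 1 := by
  simp only [prodMeasure]
  rw [← Fintype.prod_sum fun (_ : Fin k) z => π z]
  simp [hπ1]

theorem pow_sub_pow_le_tvDist_prod (k : ℕ) (hπ1 : ∑ x, π x = 1) (hP1 : ∀ x, ∑ y, P t x y = 1)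
    (x y : Ω) :
    π y ^ k - P t x y ^ k ≤ tvDist (prodSemigroup k P) (prodMeasure k π) t := by
  have h := sub_le_tvDist (P := prodSemigroup k P) (sum_prodMeasure k hπ1)
    (sum_prodSemigroup k hP1) (fun _ => x) (fun _ => y)
  simpa [prodSemigroup, prodMeasure] using h

end Distances

/-! ### The chain `X^n` -/

section Chain

open scoped Matrix

variable {n : ℕ}

theorem backRate_pos (n : ℕ) : 0 < backRate n := by unfold backRate; positivity

theorem backRate_le_one (n : ℕ) : backRate n ≤ 1 := by
  unfold backRate
  rw [div_le_one (by positivity)]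
  exact one_le_pow₀ (by norm_num)

/-- Kolmogorov's condition on the cycle formed by the extra edge and the path from `B` to `C`; this
is what makes the chain reversible. -/
theorem greenBackRate_eq (n : ℕ) : greenBackRate n = ((n : ℝ) - 1) * backRate n ^ n := by
  rw [greenBackRate, backRate, one_div, inv_pow, ← pow_mul, show n ^ 2 * n = n ^ 3 by ring]
  rfl

theorem greenBackRate_pos (hn : 2 ≤ n) : 0 < greenBackRate n := by
  have : (2 : ℝ) ≤ n := by exact_mod_cast hn
  rw [greenBackRate_eq]
  exact mul_pos (by linarith) (pow_pos (backRate_pos n) n)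

theorem one_sub_inv_pos (hn : 2 ≤ n) : 0 < 1 - 1 / (n : ℝ) := by
  have : (2 : ℝ) ≤ n := by exact_mod_cast hn
  have : 1 / (n : ℝ) ≤ 1 / 2 := one_div_le_one_div_of_le (by norm_num) this
  linarith

theorem rate_nonneg (hn : 2 ≤ n) (x y : Vertex n) : 0 ≤ rate n x y := by
  have h1 := (backRate_pos n).le
  have h2 := (greenBackRate_pos hn).le
  have h3 := (one_sub_inv_pos hn).le
  have h4 : 0 ≤ 1 / (n : ℝ) := by positivity
  unfold rate
  refine add_nonneg (add_nonneg (add_nonneg ?_ ?_) ?_) ?_ <;> split_ifs <;>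
    first | assumption | norm_num

theorem rate_succ_pos (hn : 2 ≤ n) {x y : Vertex n} (h : y.val = x.val + 1) : 0 < rate n x y := by
  have h1 : ¬ x.val = y.val + 1 := by omega
  have h2 : ¬ (x.val = n ∧ y.val = 2 * n) := by omega
  have h3 : ¬ (x.val = 2 * n ∧ y.val = n) := by omega
  have h4 : 0 < 1 / (n : ℝ) := by positivity
  simp only [rate, if_pos h, if_neg h1, if_neg h2, if_neg h3, add_zero]
  split_ifs
  · exact h4
  · norm_num

theorem rate_pred_pos (hn : 2 ≤ n) {x y : Vertex n} (h : x.val = y.val + 1) : 0 < rate n x y := by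
  have h1 : ¬ y.val = x.val + 1 := by omega
  have h2 : ¬ (x.val = n ∧ y.val = 2 * n) := by omega
  have h3 : ¬ (x.val = 2 * n ∧ y.val = n) := by omega
  simp only [rate, if_pos h, if_neg h1, if_neg h2, if_neg h3, add_zero, zero_add]
  exact backRate_pos n

theorem rate_isIrreducible (hn : 2 ≤ n) : IsIrreducible (rate n) := by
  have hup : ∀ (k : ℕ) (x y : Vertex n), y.val = x.val + k →
      Relation.ReflTransGen (fun u v => u ≠ v ∧ 0 < rate n u v) x y ∧
      Relation.ReflTransGen (fun u v => u ≠ v ∧ 0 < rate n u v) y x := by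
    intro k
    induction k with
    | zero =>
      intro x y h
      have : x = y := Fin.ext h.symm
      subst this
      exact ⟨.refl, .refl⟩
    | succ k ih =>
      intro x y h
      have hlt : x.val + k < 2 * n + 1 := by omega
      obtain ⟨h1, h2⟩ := ih x ⟨x.val + k, hlt⟩ rfl
      have hne : (⟨x.val + k, hlt⟩ : Vertex n) ≠ y := by
        intro he
        have := congrArg Fin.val he
        simp only at this
        omega
      exact ⟨h1.tail ⟨hne, rate_succ_pos hn h⟩, h2.head ⟨hne.symm, rate_pred_pos hn h⟩⟩
  intro x y
  rcases le_total x.val y.val with h | h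
  · exact (hup (y.val - x.val) x y (by omega)).1
  · exact (hup (x.val - y.val) y x (by omega)).2

/-- An unnormalised reversible measure of `X^n`. -/
noncomputable def weight (n : ℕ) (x : Vertex n) : ℝ :=
  (if x.val ≤ n then 1 else 1 / (n : ℝ)) * (backRate n)⁻¹ ^ x.val

theorem weight_pos (hn : 2 ≤ n) (x : Vertex n) : 0 < weight n x := by
  have h1 : 0 < 1 / (n : ℝ) := by positivity
  refine mul_pos ?_ (pow_pos (inv_pos.2 (backRate_pos n)) _)
  split_ifs
  · norm_num
  · exact h1

theorem weight_reversible (hn : 2 ≤ n) (x y : Vertex n) :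
    weight n x * rate n x y = weight n y * rate n y x := by
  have hε := (backRate_pos n).ne'
  have hn0 : (n : ℝ) ≠ 0 := by positivity
  have hpath : ∀ x y : Vertex n,
      weight n x * (if y.val = x.val + 1 then (if x.val = n then 1 / (n : ℝ) else 1) else 0)
        = weight n y * (if y.val = x.val + 1 then backRate n else 0) := by
    intro x y
    split_ifs with h h'
    · rw [weight, weight, if_pos h'.le, if_neg (by omega), h, pow_succ]
      field_simp
    · rw [weight, weight, h, pow_succ]
      by_cases hx : x.val ≤ n
      · rw [if_pos hx, if_pos (by omega)]; field_simp
      · rw [if_neg hx, if_neg (by omega)]; field_simp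
    · simp
  have hgreen : ∀ x y : Vertex n,
      weight n x * (if x.val = n ∧ y.val = 2 * n then 1 - 1 / (n : ℝ) else 0)
        = weight n y * (if y.val = 2 * n ∧ x.val = n then greenBackRate n else 0) := by
    intro x y
    by_cases h : x.val = n ∧ y.val = 2 * n
    · rw [if_pos h, if_pos h.symm, weight, weight, if_pos h.1.le, if_neg (by omega), h.1, h.2,
        greenBackRate_eq, two_mul, pow_add, inv_pow]
      field_simp
    · rw [if_neg h, if_neg (fun h' => h h'.symm), mul_zero, mul_zero]
  have h1 := hpath x y
  have h2 := hpath y x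
  have h3 := hgreen x y
  have h4 := hgreen y x
  simp only [rate, mul_add]
  linarith

theorem existsUnique_isReversibleProb (hn : 2 ≤ n) :
    ∃! π : Vertex n → ℝ, IsReversibleProb (rate n) π := by
  have hS : 0 < ∑ x, weight n x := Finset.sum_pos (fun x _ => weight_pos hn x) ⟨0, Finset.mem_univ _⟩
  have hex : IsReversibleProb (rate n) fun x => weight n x / ∑ y, weight n y := by
    refine ⟨fun x => (div_pos (weight_pos hn x) hS).le, ?_, fun x y => ?_⟩
    · rw [← Finset.sum_div, div_self hS.ne']
    · rw [div_mul_eq_mul_div, div_mul_eq_mul_div, weight_reversible hn]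
  exact ⟨_, hex, fun π hπ => hπ.unique (rate_isIrreducible hn) hex⟩

theorem generator_rate_mulVec (hn : 2 ≤ n) (W : ℕ → ℝ) (x : Vertex n) :
    (generator (rate n) *ᵥ fun y => W y.val) x
      = (if x.val < 2 * n then (if x.val = n then 1 / (n : ℝ) else 1) * (W (x.val + 1) - W x.val)
          else 0)
        + (if 0 < x.val then backRate n * (W (x.val - 1) - W x.val) else 0)
        + (if x.val = n then (1 - 1 / (n : ℝ)) * (W (2 * n) - W n) else 0)
        + (if x.val = 2 * n then greenBackRate n * (W n - W (2 * n)) else 0) := by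
  have hpick : ∀ (k : ℕ) (hk : k < 2 * n + 1) (c : ℝ) (f : ℕ → ℝ),
      ∑ y : Vertex n, (if y.val = k then c else 0) * f y.val = c * f k := by
    intro k hk c f
    rw [Finset.sum_eq_single ⟨k, hk⟩]
    · simp
    · intro y _ hy
      rw [if_neg fun h => hy (Fin.ext h), zero_mul]
    · simp
  rw [generator_mulVec]
  simp only [rate, add_mul, Finset.sum_add_distrib]
  have hx := x.isLt
  congr 1
  · congr 1
    · congr 1
      · by_cases h : x.val < 2 * n
        · rw [if_pos h, hpick _ (by omega) _ fun k => W k - W x.val]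
        · rw [if_neg h]
          exact Finset.sum_eq_zero fun y _ => by
            rw [if_neg (by have := y.isLt; omega), zero_mul]
      · split_ifs with h
        · rw [← hpick (x.val - 1) (by omega) _ fun k => W k - W x.val]
          refine Finset.sum_congr rfl fun y _ => ?_
          have : x.val = y.val + 1 ↔ y.val = x.val - 1 := by omega
          simp only [this]
        · exact Finset.sum_eq_zero fun y _ => by rw [if_neg (by omega), zero_mul]
    · split_ifs with h
      · simp only [h, true_and]
        rw [hpick _ (by omega) _ fun k => W k - W n]
      · simp [h]
  · split_ifs with h
    · simp only [h, true_and]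
      rw [hpick _ (by omega) _ fun k => W k - W (2 * n)]
    · simp [h]

/-- The last vertex `C`. -/
def vertexC (n : ℕ) : Vertex n := Fin.last (2 * n)

theorem IsReversibleProb.eq_backRate_mul {π : Vertex n → ℝ}
    (hπ : IsReversibleProb (rate n) π) (hn : 2 ≤ n) {x y : Vertex n} (h : y.val = x.val + 1) :
    π x = (if x.val = n then (n : ℝ) else 1) * (backRate n * π y) := by
  have hrev := hπ.2.2 x y
  have h1 : ¬ x.val = y.val + 1 := by omega
  have h2 : ¬ (x.val = n ∧ y.val = 2 * n) := by omega
  have h3 : ¬ (x.val = 2 * n ∧ y.val = n) := by omega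
  have h4 : ¬ (y.val = n ∧ x.val = 2 * n) := by omega
  have h5 : ¬ (y.val = 2 * n ∧ x.val = n) := by omega
  have hn0 : (n : ℝ) ≠ 0 := by positivity
  simp only [rate, if_pos h, if_neg h1, if_neg h2, if_neg h3, if_neg h4, if_neg h5, add_zero,
    zero_add] at hrev
  split_ifs at hrev ⊢
  · field_simp at hrev
    linarith
  · linarith

theorem natCast_mul_backRate_le_one (n : ℕ) : (n : ℝ) * backRate n ≤ 1 := by
  rw [backRate, mul_one_div, div_le_one (by positivity)]
  have h : n ≤ 2 ^ n ^ 2 :=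
    Nat.lt_two_pow_self.le.trans (Nat.pow_le_pow_right (by norm_num) (Nat.le_self_pow (by norm_num) n))
  exact_mod_cast h

theorem IsReversibleProb.le_backRate {π : Vertex n → ℝ} (hπ : IsReversibleProb (rate n) π)
    (hn : 2 ≤ n) {x : Vertex n} (hx : x.val < 2 * n) : π x ≤ backRate n := by
  have hε := backRate_pos n
  have hle : ∀ y, π y ≤ 1 := fun y => by
    rw [← hπ.2.1]; exact Finset.single_le_sum (fun z _ => hπ.1 z) (Finset.mem_univ y)
  have hstep : ∀ x : Vertex n, x.val < 2 * n → x.val ≠ n → π x ≤ backRate n := by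
    intro x hx hxn
    rw [hπ.eq_backRate_mul hn (y := ⟨x.val + 1, by omega⟩) rfl, if_neg hxn, one_mul]
    exact mul_le_of_le_one_right hε.le (hle _)
  -- At `B` detailed balance gives an extra factor `n`; a second factor `backRate n`, gained at the
  -- next vertex, absorbs it.
  by_cases hxn : x.val = n
  · have h := hstep ⟨x.val + 1, by omega⟩ (by simp only; omega) (by simp only; omega)
    rw [hπ.eq_backRate_mul hn (y := ⟨x.val + 1, by omega⟩) rfl, if_pos hxn, ← mul_assoc]
    have := mul_le_mul (natCast_mul_backRate_le_one n) h (hπ.1 _) zero_le_one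
    linarith
  · exact hstep x hx hxn

theorem IsReversibleProb.one_sub_le_vertexC {π : Vertex n → ℝ}
    (hπ : IsReversibleProb (rate n) π) (hn : 2 ≤ n) :
    1 - 2 * n * backRate n ≤ π (vertexC n) := by
  have h := hπ.2.1
  rw [Fin.sum_univ_castSucc] at h
  have h2 : ∑ i : Fin (2 * n), π i.castSucc ≤ ∑ _i : Fin (2 * n), backRate n :=
    Finset.sum_le_sum fun i _ => hπ.le_backRate hn (by simp)
  simp only [Finset.sum_const, Finset.card_univ, Fintype.card_fin, nsmul_eq_mul, Nat.cast_mul,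
    Nat.cast_ofNat] at h2
  unfold vertexC
  linarith

end Chain

/-! ### Barriers for the hitting probabilities of `C` -/

section Barriers

open scoped Matrix

variable {n : ℕ}

/-- The generator of `X^n`, acting on functions on `ℕ`. -/
noncomputable def pathGenerator (n : ℕ) (V : ℕ → ℝ) (i : ℕ) : ℝ :=
  if i = n then
    1 / (n : ℝ) * (V (n + 1) - V n) + backRate n * (V (n - 1) - V n)
      + (1 - 1 / (n : ℝ)) * (V (2 * n) - V n)
  else if i < 2 * n then
    V (i + 1) - V i + backRate n * (V (i - 1) - V i)
  else
    backRate n * (V (2 * n - 1) - V (2 * n)) + greenBackRate n * (V n - V (2 * n))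

theorem generator_rate_mulVec_eq_pathGenerator (hn : 2 ≤ n) (V : ℕ → ℝ) (x : Vertex n) :
    (generator (rate n) *ᵥ fun y => V y.val) x = pathGenerator n V x.val := by
  rw [generator_rate_mulVec hn, pathGenerator]
  have hx := x.isLt
  by_cases h : x.val = n
  · have h1 : x.val < 2 * n := by omega
    have h2 : 0 < x.val := by omega
    have h3 : ¬ x.val = 2 * n := by omega
    simp only [if_pos h, if_pos h1, if_pos h2, if_neg h3, add_zero]
    rw [h]
  by_cases h' : x.val < 2 * n
  · have h3 : ¬ x.val = 2 * n := by omega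
    simp only [if_neg h, if_pos h', if_neg h3, add_zero, one_mul]
    split_ifs with h0
    · rfl
    -- Truncated subtraction makes the backward term vanish at `0`, so `A` needs no case of its own.
    · have h0 : x.val = 0 := by omega
      rw [h0, Nat.zero_sub]
      ring
  · have h2 : x.val = 2 * n := by omega
    have h3 : 0 < x.val := by omega
    simp only [if_neg h, if_neg h', if_pos h2, if_pos h3, zero_add, add_zero]
    rw [h2]

/-- `A e^{κ s} + B + η s` is a supersolution up to time `t`. -/
def IsBarrier (n : ℕ) (A B : ℕ → ℝ) (κ η t : ℝ) : Prop :=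
  ∀ s, 0 ≤ s → s ≤ t → ∀ i ≤ 2 * n,
    pathGenerator n (fun j => A j * Real.exp (κ * s) + B j) i ≤ κ * A i * Real.exp (κ * s) + η

theorem IsBarrier.semigroup_mulVec_le {A B : ℕ → ℝ} {κ η t : ℝ} (h : IsBarrier n A B κ η t)
    (hn : 2 ≤ n) (ht : 0 ≤ t) {f : Vertex n → ℝ} (hf : ∀ y, f y ≤ A y.val + B y.val)
    (x : Vertex n) :
    (semigroup (rate n) t *ᵥ f) x ≤ A x.val * Real.exp (κ * t) + B x.val + η * t := by
  refine semigroup_mulVec_le_of_supersolution (rate_nonneg hn) ht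
    (w := fun s y => A y.val * Real.exp (κ * s) + B y.val + η * s)
    (w' := fun s y => κ * A y.val * Real.exp (κ * s) + η) (fun y => by simpa using hf y)
    (fun s y => ?_) (fun s h0 h1 y => ?_) x
  · have h1 := ((((hasDerivAt_id s).const_mul κ).exp.const_mul (A y.val)).add_const (B y.val)).add
      ((hasDerivAt_id s).const_mul η)
    refine h1.congr_deriv ?_
    simp only [id_eq, mul_one]
    ring
  · refine le_trans (le_of_eq ?_) (h s h0 h1 y.val (by have := y.isLt; omega))
    rw [← generator_rate_mulVec_eq_pathGenerator hn, generator_mulVec, generator_mulVec]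
    exact Finset.sum_congr rfl fun z _ => by ring

theorem eq_vertexC_iff (y : Vertex n) : y = vertexC n ↔ y.val = 2 * n := by
  rw [Fin.ext_iff, vertexC, Fin.val_last]

theorem IsBarrier.semigroup_le {A B : ℕ → ℝ} {κ η t : ℝ} (h : IsBarrier n A B κ η t)
    (hn : 2 ≤ n) (ht : 0 ≤ t) (hAB : ∀ i < 2 * n, 0 ≤ A i + B i) (hC : 1 ≤ A (2 * n) + B (2 * n))
    (x : Vertex n) :
    semigroup (rate n) t x (vertexC n) ≤ A x.val * Real.exp (κ * t) + B x.val + η * t := by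
  rw [← semigroup_mulVec_single]
  refine h.semigroup_mulVec_le hn ht (fun y => ?_) x
  split_ifs with hy
  · rwa [(eq_vertexC_iff y).1 hy]
  · exact hAB _ (by have := mt (eq_vertexC_iff y).2 hy; have := y.isLt; omega)

theorem IsBarrier.one_sub_semigroup_le {A B : ℕ → ℝ} {κ η t : ℝ} (h : IsBarrier n A B κ η t)
    (hn : 2 ≤ n) (ht : 0 ≤ t) (hAB : ∀ i < 2 * n, 1 ≤ A i + B i) (hC : 0 ≤ A (2 * n) + B (2 * n))
    (x : Vertex n) :
    1 - semigroup (rate n) t x (vertexC n) ≤ A x.val * Real.exp (κ * t) + B x.val + η * t := by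
  rw [← semigroup_mulVec_compl (rate_nonneg hn) ht]
  refine h.semigroup_mulVec_le hn ht (fun y => ?_) x
  split_ifs with hy
  · rwa [(eq_vertexC_iff y).1 hy]
  · exact hAB _ (by have := mt (eq_vertexC_iff y).2 hy; have := y.isLt; omega)

/-! ### Algebra of the powers in the barriers. -/

theorem pow_sub_pred_le {z : ℝ} (hz : 1 ≤ z) (a i : ℕ) : z ^ (a - (i - 1)) ≤ z * z ^ (a - i) := by
  rw [← pow_succ']
  exact pow_le_pow_right₀ hz (by omega)

theorem mul_pow_sub_succ (z : ℝ) {a i : ℕ} (h : i < a) : z * z ^ (a - (i + 1)) = z ^ (a - i) := by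
  rw [← pow_succ']
  congr 1
  omega

theorem exp_neg_mul_le_one {k s : ℝ} (hk : 0 ≤ k) (hs : 0 ≤ s) : Real.exp (-k * s) ≤ 1 := by
  rw [Real.exp_le_one_iff]
  nlinarith

/-- Every starting point reaches `C` by walking along the path. -/
theorem one_sub_semigroup_le_of_path (hn : 2 ≤ n) {z k t : ℝ} (ht : 0 ≤ t) (hz : 1 ≤ z)
    (hk0 : 0 ≤ k) (hk : 1 - z + backRate n * (z - 1) * z + k * z ≤ 0) (x : Vertex n) :
    1 - semigroup (rate n) t x (vertexC n)
      ≤ z ^ (2 * n) * Real.exp (-k * t) + (backRate n + greenBackRate n) * z ^ (2 * n) * t := by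
  have hε := backRate_pos n
  have hε' := greenBackRate_pos hn
  have hz0 : 0 < z := by linarith
  have hn1 : 0 ≤ 1 / (n : ℝ) := by positivity
  have hn2 := one_sub_inv_pos hn
  -- The exponent counts the remaining steps, and `hk` is the drift inequality giving decay at rate
  -- `k`. The extra edge only helps, since `A` vanishes at `C`; `η` pays for the escapes from `C`.
  set A : ℕ → ℝ := fun i => if i < 2 * n then z ^ (2 * n - i) else 0 with hA
  have hAle : ∀ i, A i ≤ z ^ (2 * n - i) := fun i => by
    simp only [hA]; split_ifs
    · exact le_rfl
    · positivity
  have hA0 : ∀ i, 0 ≤ A i := fun i => by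
    simp only [hA]; split_ifs <;> positivity
  have hbar : IsBarrier n A (fun _ => 0) (-k) ((backRate n + greenBackRate n) * z ^ (2 * n)) t := by
    intro s hs _ i hi
    set E := Real.exp (-k * s)
    have hE0 : 0 < E := Real.exp_pos _
    have hE1 : E ≤ 1 := exp_neg_mul_le_one hk0 hs
    have hη : 0 ≤ (backRate n + greenBackRate n) * z ^ (2 * n) := by positivity
    rcases Nat.lt_or_ge i (2 * n) with hlt | hge
    · have hAi : A i = z * z ^ (2 * n - (i + 1)) := by
        rw [mul_pow_sub_succ z hlt]; simp only [hA, if_pos hlt]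
      have hpred : A (i - 1) ≤ z * A i :=
        (hAle _).trans ((pow_sub_pred_le hz _ _).trans_eq (by simp only [hA, if_pos hlt]))
      have hsucc := hAle (i + 1)
      set p := z ^ (2 * n - (i + 1))
      have hp : 0 < p := by positivity
      have h1 := mul_le_mul_of_nonneg_left hpred (mul_pos hε hE0).le
      have h2 := mul_nonpos_of_nonpos_of_nonneg hk (mul_pos hp hE0).le
      have h3 := mul_le_mul_of_nonneg_right hsucc hE0.le
      rw [hAi] at h1 ⊢
      rw [pathGenerator]
      split_ifs with hin
      · have h4 : A (2 * n) = 0 := by simp [hA]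
        have h5 := mul_le_mul_of_nonneg_left h3 hn1
        have h6 := mul_nonneg hn2.le (mul_pos hp hE0).le
        subst hin
        simp only [h4, hAi]
        nlinarith
      · simp only [hAi]
        nlinarith
    · have hi2 : i = 2 * n := le_antisymm hi hge
      subst hi2
      have h4 : A (2 * n) = 0 := by simp [hA]
      have h5 : A (2 * n - 1) ≤ z ^ (2 * n) :=
        (hAle _).trans (pow_le_pow_right₀ hz (Nat.sub_le _ _))
      have h6 : A n ≤ z ^ (2 * n) := (hAle _).trans (pow_le_pow_right₀ hz (Nat.sub_le _ _))
      rw [pathGenerator, if_neg (by omega), if_neg (by omega)]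
      simp only [h4]
      have h7 := mul_le_mul h5 hE1 hE0.le (by positivity)
      have h8 := mul_le_mul h6 hE1 hE0.le (by positivity)
      have h9 := mul_le_mul_of_nonneg_left h7 hε.le
      have h10 := mul_le_mul_of_nonneg_left h8 hε'.le
      nlinarith
  have h := hbar.one_sub_semigroup_le hn ht (fun i hi => ?_) ?_ x
  · refine h.trans ?_
    have := mul_le_mul_of_nonneg_right
      ((hAle x.val).trans (pow_le_pow_right₀ hz (Nat.sub_le _ _))) (Real.exp_pos (-k * t)).le
    linarith
  · simp only [hA, if_pos hi, add_zero]
    exact one_le_pow₀ hz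
  · simpa using hA0 _

/-- A walker from `A` takes the extra edge, unless it leaves `B` along the path. -/
theorem one_sub_semigroup_le_of_le (hn : 2 ≤ n) {z k t : ℝ} (ht : 0 ≤ t) (hz : 1 ≤ z)
    (hk0 : 0 ≤ k) (hk : 1 - z + backRate n * (z - 1) * z + k * z ≤ 0) {x : Vertex n}
    (hx : x.val ≤ n) :
    1 - semigroup (rate n) t x (vertexC n)
      ≤ 1 / n + z ^ (n + 1) * Real.exp (-k * t)
        + 2 * (backRate n + greenBackRate n) * z ^ (2 * n) * t := by
  have hε := backRate_pos n
  have hε' := greenBackRate_pos hn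
  have hz0 : 0 < z := by linarith
  have hn1 : 0 < 1 / (n : ℝ) := by positivity
  have hn2 := one_sub_inv_pos hn
  -- The exponent is `1` at `B`, for the jump out of `B`. In `B`, a walker between `B` and `C`
  -- counts as failed for ever; the value `1/n` up to vertex `B` is then harmonic there for the
  -- forward jumps.
  set A : ℕ → ℝ := fun i => if i ≤ n then z ^ (n + 1 - i) else 0 with hA
  set B : ℕ → ℝ := fun i => if i ≤ n then 1 / (n : ℝ) else if i < 2 * n then 1 else 0 with hB
  have hAle : ∀ i, A i ≤ z ^ (n + 1 - i) := fun i => by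
    simp only [hA]; split_ifs
    · exact le_rfl
    · positivity
  have hAle2 : ∀ i, A i ≤ z ^ (2 * n) := fun i =>
    (hAle i).trans (pow_le_pow_right₀ hz (by omega))
  have hA0 : ∀ i, 0 ≤ A i := fun i => by
    simp only [hA]; split_ifs <;> positivity
  have hB0 : ∀ i, 0 ≤ B i := fun i => by
    simp only [hB]; split_ifs <;> positivity
  have hB1 : ∀ i, B i ≤ 1 := fun i => by
    simp only [hB]; split_ifs <;> linarith
  have hZ : 1 ≤ z ^ (2 * n) := one_le_pow₀ hz
  have hbar : IsBarrier n A B (-k) (2 * (backRate n + greenBackRate n) * z ^ (2 * n)) t := by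
    intro s hs _ i hi
    set E := Real.exp (-k * s)
    have hE0 : 0 < E := Real.exp_pos _
    have hE1 : E ≤ 1 := exp_neg_mul_le_one hk0 hs
    have hεZ := mul_pos hε (zero_lt_one.trans_le hZ)
    have hεZ' := mul_pos hε' (zero_lt_one.trans_le hZ)
    have hcap : ∀ j, A j * E + B j ≤ 2 * z ^ (2 * n) := fun j => by
      have := mul_le_mul (hAle2 j) hE1 hE0.le (by positivity)
      linarith [hB1 j]
    rcases Nat.lt_trichotomy i n with hlt | heq | hgt
    · have hAi : A i = z * z ^ (n + 1 - (i + 1)) := by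
        rw [mul_pow_sub_succ z (by omega)]; simp only [hA, if_pos hlt.le]
      have hpred : A (i - 1) ≤ z * A i :=
        (hAle _).trans ((pow_sub_pred_le hz _ _).trans_eq (by simp only [hA, if_pos hlt.le]))
      have hsucc := hAle (i + 1)
      have hBi : B i = 1 / n := by simp only [hB, if_pos hlt.le]
      have hBi1 : B (i + 1) = 1 / n := by simp only [hB]; rw [if_pos (by omega)]
      have hBi2 : B (i - 1) = 1 / n := by simp only [hB]; rw [if_pos (by omega)]
      set p := z ^ (n + 1 - (i + 1))
      have hp : 0 < p := by positivity
      have h1 := mul_le_mul_of_nonneg_left hpred (mul_pos hε hE0).le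
      have h2 := mul_nonpos_of_nonpos_of_nonneg hk (mul_pos hp hE0).le
      have h3 := mul_le_mul_of_nonneg_right hsucc hE0.le
      rw [hAi] at h1 ⊢
      rw [pathGenerator, if_neg (by omega), if_pos (by omega)]
      simp only [hBi, hBi1, hBi2, hAi]
      nlinarith
    · subst heq
      have hAi : A i = z := by simp [hA]
      have hpred : A (i - 1) ≤ z * z := by
        refine (hAle _).trans ?_
        rw [← pow_two]
        exact pow_le_pow_right₀ hz (by omega)
      have hAs : A (i + 1) = 0 := by simp [hA]
      have hAC : A (2 * i) = 0 := by simp only [hA]; rw [if_neg (by omega)]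
      have hBi : B i = 1 / i := by simp [hB]
      have hBs : B (i + 1) = 1 := by simp only [hB]; rw [if_neg (by omega), if_pos (by omega)]
      have hBp : B (i - 1) = 1 / i := by simp [hB]
      have hBC : B (2 * i) = 0 := by simp only [hB]; rw [if_neg (by omega), if_neg (by omega)]
      have h1 := mul_le_mul_of_nonneg_left hpred (mul_pos hε hE0).le
      have h2 := mul_nonpos_of_nonpos_of_nonneg hk hE0.le
      rw [pathGenerator, if_pos rfl]
      simp only [hBi, hBs, hBp, hBC, hAi, hAs, hAC]
      nlinarith
    · have hAi : A i = 0 := by simp only [hA]; rw [if_neg (by omega)]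
      rcases Nat.lt_or_ge i (2 * n) with hlt | hge
      · have hBi : B i = 1 := by simp only [hB]; rw [if_neg (by omega), if_pos hlt]
        have hAs : A (i + 1) = 0 := by simp only [hA]; rw [if_neg (by omega)]
        have h1 := mul_le_mul_of_nonneg_left (hcap (i - 1)) hε.le
        have h2 := hB1 (i + 1)
        rw [pathGenerator, if_neg (by omega), if_pos hlt]
        simp only [hBi, hAi, hAs]
        nlinarith
      · have hi2 : i = 2 * n := le_antisymm hi hge
        subst hi2
        have hBi : B (2 * n) = 0 := by simp only [hB]; rw [if_neg (by omega), if_neg (by omega)]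
        have h1 := mul_le_mul_of_nonneg_left (hcap (2 * n - 1)) hε.le
        have h2 := mul_le_mul_of_nonneg_left (hcap n) hε'.le
        rw [pathGenerator, if_neg (by omega), if_neg (by omega)]
        simp only [hBi, hAi]
        nlinarith
  have h := hbar.one_sub_semigroup_le hn ht (fun i hi => ?_) ?_ x
  · refine h.trans ?_
    have h1 := mul_le_mul_of_nonneg_right
      ((hAle x.val).trans (pow_le_pow_right₀ hz (Nat.sub_le _ _))) (Real.exp_pos (-k * t)).le
    have h2 : B x.val = 1 / n := by simp only [hB]; rw [if_pos hx]
    linarith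
  · simp only [hA, hB]
    split_ifs with h1
    · have : 1 ≤ z ^ (n + 1 - i) := one_le_pow₀ hz
      linarith
    · norm_num
  · exact add_nonneg (hA0 _) (hB0 _)

/-- A walker from beyond `B` walks along the rest of the path. -/
theorem one_sub_semigroup_le_of_lt (hn : 2 ≤ n) {z k t : ℝ} (ht : 0 ≤ t) (hz : 1 ≤ z)
    (hk0 : 0 ≤ k) (hk : 1 - z + backRate n * (z - 1) * z + k * z ≤ 0) {x : Vertex n}
    (hx : n < x.val) :
    1 - semigroup (rate n) t x (vertexC n)
      ≤ z ^ n * Real.exp (-k * t) + 2 * (backRate n + greenBackRate n) * z ^ (2 * n) * t := by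
  have hε := backRate_pos n
  have hε' := greenBackRate_pos hn
  have hz0 : 0 < z := by linarith
  have hn1 : 0 < 1 / (n : ℝ) := by positivity
  have hn2 := one_sub_inv_pos hn
  -- Falling back to vertex `B` happens at rate `backRate n` and is charged to `η`. The constant `z
  -- ^ n` up to vertex `B` is large enough to dominate every value of `A`.
  set A : ℕ → ℝ := fun i => if i ≤ n then 0 else if i < 2 * n then z ^ (2 * n - i) else 0 with hA
  set B : ℕ → ℝ := fun i => if i ≤ n then z ^ n else 0 with hB
  have hAle : ∀ i, A i ≤ z ^ (2 * n - i) := fun i => by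
    simp only [hA]; split_ifs
    · positivity
    · exact le_rfl
    · positivity
  have hAn : ∀ i, A i ≤ z ^ n := fun i => by
    by_cases hi : i ≤ n
    · simp only [hA, if_pos hi]; positivity
    · exact (hAle i).trans (pow_le_pow_right₀ hz (by omega))
  have hA0 : ∀ i, 0 ≤ A i := fun i => by
    simp only [hA]; split_ifs <;> positivity
  have hB0 : ∀ i, 0 ≤ B i := fun i => by
    simp only [hB]; split_ifs <;> positivity
  have hBn : ∀ i, B i ≤ z ^ n := fun i => by
    simp only [hB]; split_ifs
    · exact le_rfl
    · positivity
  have hZn : 1 ≤ z ^ n := one_le_pow₀ hz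
  have hZ : z ^ n ≤ z ^ (2 * n) := pow_le_pow_right₀ hz (by omega)
  have hbar : IsBarrier n A B (-k) (2 * (backRate n + greenBackRate n) * z ^ (2 * n)) t := by
    intro s hs _ i hi
    set E := Real.exp (-k * s)
    have hE0 : 0 < E := Real.exp_pos _
    have hE1 : E ≤ 1 := exp_neg_mul_le_one hk0 hs
    have hεZ := mul_le_mul_of_nonneg_left hZ hε.le
    have hεZ' := mul_le_mul_of_nonneg_left hZ hε'.le
    have hεZ0 : 0 ≤ backRate n * z ^ n := by positivity
    have hεZ0' : 0 ≤ greenBackRate n * z ^ n := by positivity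
    have hAE : ∀ j, A j * E ≤ z ^ n := fun j =>
      (mul_le_mul (hAn j) hE1 hE0.le (by positivity)).trans_eq (mul_one _)
    rcases Nat.lt_trichotomy i n with hlt | heq | hgt
    · have hAi : ∀ j ≤ n, A j = 0 := fun j hj => by simp only [hA, if_pos hj]
      have hBi : ∀ j ≤ n, B j = z ^ n := fun j hj => by simp only [hB, if_pos hj]
      rw [pathGenerator, if_neg (by omega), if_pos (by omega)]
      simp only [hAi i hlt.le, hAi (i + 1) hlt, hAi (i - 1) (by omega), hBi i hlt.le,
        hBi (i + 1) hlt, hBi (i - 1) (by omega)]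
      nlinarith
    · have hAi : ∀ j ≤ n, A j = 0 := fun j hj => by simp only [hA, if_pos hj]
      have hBi : ∀ j ≤ n, B j = z ^ n := fun j hj => by simp only [hB, if_pos hj]
      have hAC : A (2 * n) = 0 := by simp [hA]
      have hBs : B (n + 1) = 0 := by simp [hB]
      have hBC : B (2 * n) = 0 := by simp only [hB]; rw [if_neg (by omega)]
      have h1 := mul_le_mul_of_nonneg_left (hAE (n + 1)) hn1.le
      have h2 := mul_nonneg hn2.le (by positivity : 0 ≤ z ^ n)
      rw [pathGenerator, if_pos heq]
      simp only [hAi i heq.le, hAi n le_rfl, hAi (n - 1) (by omega), hBi n le_rfl,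
        hBi (n - 1) (by omega), hAC, hBs, hBC]
      nlinarith
    · have hBi : ∀ j, n < j → B j = 0 := fun j hj => by simp only [hB]; rw [if_neg (by omega)]
      rcases Nat.lt_or_ge i (2 * n) with hlt | hge
      · have hAi' : A i = z ^ (2 * n - i) := by
          simp only [hA]; rw [if_neg (by omega), if_pos hlt]
        have hAi : A i = z * z ^ (2 * n - (i + 1)) := by rw [mul_pow_sub_succ z hlt, hAi']
        have hpred : A (i - 1) ≤ z * A i :=
          (hAle _).trans ((pow_sub_pred_le hz _ _).trans_eq (by rw [hAi']))
        have hsucc := hAle (i + 1)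
        set p := z ^ (2 * n - (i + 1))
        have hp : 0 < p := by positivity
        have h1 := mul_le_mul_of_nonneg_left hpred (mul_pos hε hE0).le
        have h2 := mul_nonpos_of_nonpos_of_nonneg hk (mul_pos hp hE0).le
        have h3 := mul_le_mul_of_nonneg_right hsucc hE0.le
        have h4 := mul_le_mul_of_nonneg_left (hBn (i - 1)) hε.le
        rw [hAi] at h1 ⊢
        rw [pathGenerator, if_neg (by omega), if_pos hlt]
        simp only [hBi i hgt, hBi (i + 1) (by omega), hAi]
        nlinarith
      · have hi2 : i = 2 * n := le_antisymm hi hge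
        subst hi2
        have hAC : A (2 * n) = 0 := by simp [hA]
        have hAB : A n = 0 := by simp [hA]
        have h1 := mul_le_mul_of_nonneg_left (hAE (2 * n - 1)) hε.le
        have h2 := mul_le_mul_of_nonneg_left (hBn (2 * n - 1)) hε.le
        have h3 := mul_le_mul_of_nonneg_left (hBn n) hε'.le
        rw [pathGenerator, if_neg (by omega), if_neg (by omega)]
        simp only [hBi (2 * n) (by omega), hAC, hAB]
        nlinarith
  have h := hbar.one_sub_semigroup_le hn ht (fun i hi => ?_) ?_ x
  · refine h.trans ?_
    have h1 := mul_le_mul_of_nonneg_right (hAn x.val) (Real.exp_pos (-k * t)).le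
    have h2 : B x.val = 0 := by simp only [hB]; rw [if_neg (by omega)]
    linarith
  · simp only [hA, hB]
    by_cases h1 : i ≤ n
    · rw [if_pos h1, if_pos h1]; linarith
    · rw [if_neg h1, if_neg h1, if_pos hi, add_zero]; exact one_le_pow₀ hz
  · exact add_nonneg (hA0 _) (hB0 _)

/-- `C` is not reached from `A` before `B` is. -/
theorem semigroup_zero_vertexC_le_exp (hn : 2 ≤ n) {z k t : ℝ} (ht : 0 ≤ t) (hz0 : 0 < z)
    (hz : z ≤ 1) (hk : k * z = 1 - z) :
    semigroup (rate n) t 0 (vertexC n) ≤ z ^ n * Real.exp (k * t) := by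
  have hε := backRate_pos n
  have hε' := greenBackRate_pos hn
  have hk0 : 0 ≤ k := nonneg_of_mul_nonneg_left (hk ▸ sub_nonneg.2 hz) hz0
  -- Now `z ≤ 1`, so backward jumps lower the barrier and `η = 0` suffices; `hk` makes it exact for
  -- the forward walk before `B`. Truncated subtraction gives the value `1` from `B` on.
  have hbar : IsBarrier n (fun i => z ^ (n - i)) (fun _ => 0) k 0 t := by
    intro s hs _ i hi
    set E := Real.exp (k * s)
    have hE0 : 0 < E := Real.exp_pos _
    have hback : ∀ i, z ^ (n - (i - 1)) ≤ z ^ (n - i) := fun i =>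
      pow_le_pow_of_le_one hz0.le hz (by omega)
    rcases Nat.lt_or_ge i n with hlt | hge
    · have h1 := mul_le_mul_of_nonneg_left (hback i) (mul_pos hε hE0).le
      rw [pathGenerator, if_neg (by omega), if_pos (by omega)]
      simp only [← mul_pow_sub_succ z hlt] at h1 ⊢
      set p := z ^ (n - (i + 1))
      have h2 : k * (z * p) * E = (1 - z) * p * E := by rw [← hk]; ring
      nlinarith
    · have hone : ∀ j, n ≤ j → z ^ (n - j) = 1 := fun j hj => by
        rw [Nat.sub_eq_zero_of_le hj, pow_zero]
      have h1 := mul_le_mul_of_nonneg_left (hback i) (mul_pos hε hE0).le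
      have h3 := mul_nonneg hk0 hE0.le
      rw [hone i hge] at h1
      rw [pathGenerator]
      split_ifs with h h'
      · subst h
        simp only [hone i le_rfl, hone (i + 1) (by omega), hone (2 * i) (by omega)]
        nlinarith
      · simp only [hone i hge, hone (i + 1) (by omega)]
        nlinarith
      · have hi2 : i = 2 * n := by omega
        subst hi2
        simp only [hone n le_rfl, hone (2 * n) (by omega)]
        nlinarith
  have h := hbar.semigroup_le hn ht (fun i _ => by positivity)
    (by rw [Nat.sub_eq_zero_of_le (by omega)]; simp) 0
  simpa using h

/-- With probability about `1 / n`, `C` is reached from `A` only along the whole path. -/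
theorem semigroup_zero_vertexC_le (hn : 2 ≤ n) {z k t T : ℝ} (ht : 0 ≤ t) (htT : t ≤ T)
    (hz0 : 0 < z) (hz : z ≤ 1) (hk : k * z = 1 - z) :
    semigroup (rate n) t 0 (vertexC n)
      ≤ 1 - 1 / n + 1 / n * (z ^ (2 * n) * Real.exp (k * t))
        + 2 * (backRate n + greenBackRate n) * Real.exp (k * T) * t := by
  have hε := backRate_pos n
  have hε' := greenBackRate_pos hn
  have hk0 : 0 ≤ k := nonneg_of_mul_nonneg_left (hk ▸ sub_nonneg.2 hz) hz0
  have hn1 : 0 < 1 / (n : ℝ) := by positivity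
  have hn2 := one_sub_inv_pos hn
  -- `B` charges the extra edge with its probability `1 - 1/n`, and `A` carries the Chernoff weight
  -- of the long route with its probability `1/n`. As `e^{ks}` grows, the backward jumps are bounded
  -- by its value at the horizon `T`.
  set A : ℕ → ℝ := fun i => if i ≤ n then 1 / n * z ^ (2 * n - i) else
    if i < 2 * n then z ^ (2 * n - i) else 0 with hA
  set B : ℕ → ℝ := fun i => if i ≤ n then 1 - 1 / (n : ℝ) else if i < 2 * n then 0 else 1 with hB
  have hp1 : ∀ j, z ^ j ≤ 1 := fun j => pow_le_one₀ hz0.le hz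
  have hA0 : ∀ i, 0 ≤ A i := fun i => by
    simp only [hA]; split_ifs <;> positivity
  have hB0 : ∀ i, 0 ≤ B i := fun i => by
    simp only [hB]; split_ifs <;> linarith
  have hA1 : ∀ i, A i ≤ 1 := fun i => by
    simp only [hA]; split_ifs
    · exact mul_le_one₀ (by linarith) (by positivity) (hp1 _)
    · exact hp1 _
    · norm_num
  have hB1 : ∀ i, B i ≤ 1 := fun i => by
    simp only [hB]; split_ifs <;> linarith
  have hbar : IsBarrier n A B k (2 * (backRate n + greenBackRate n) * Real.exp (k * T)) t := by
    intro s hs hst i hi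
    have hET : Real.exp (k * s) ≤ Real.exp (k * T) :=
      Real.exp_le_exp.2 (mul_le_mul_of_nonneg_left (hst.trans htT) hk0)
    have hE1 : 1 ≤ Real.exp (k * s) := Real.one_le_exp (mul_nonneg hk0 hs)
    set E := Real.exp (k * s)
    set M := Real.exp (k * T)
    have hE0 : 0 < E := by linarith
    have hM0 : 0 < M := by linarith
    have hcap : ∀ j, A j * E + B j ≤ 2 * M := fun j => by
      have := mul_le_mul_of_nonneg_right (hA1 j) hE0.le
      linarith [hB1 j]
    have hpos : ∀ j, 0 ≤ A j * E + B j := fun j =>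
      add_nonneg (mul_nonneg (hA0 j) hE0.le) (hB0 j)
    have hback : ∀ i, z ^ (2 * n - (i - 1)) ≤ z ^ (2 * n - i) := fun i =>
      pow_le_pow_of_le_one hz0.le hz (by omega)
    have hη : 0 ≤ backRate n * M := by positivity
    have hη' : 0 ≤ greenBackRate n * M := by positivity
    have hAlow : ∀ j ≤ n, A j = 1 / n * z ^ (2 * n - j) := fun j hj => by simp only [hA, if_pos hj]
    have hBlow : ∀ j ≤ n, B j = 1 - 1 / (n : ℝ) := fun j hj => by simp only [hB, if_pos hj]
    have hAhigh : ∀ j, n < j → j < 2 * n → A j = z ^ (2 * n - j) := fun j h h' => by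
      simp only [hA]; rw [if_neg (by omega), if_pos h']
    have hBhigh : ∀ j, n < j → j < 2 * n → B j = 0 := fun j h h' => by
      simp only [hB]; rw [if_neg (by omega), if_pos h']
    have hAC : A (2 * n) = 0 := by simp only [hA]; rw [if_neg (by omega), if_neg (by omega)]
    have hBC : B (2 * n) = 1 := by simp only [hB]; rw [if_neg (by omega), if_neg (by omega)]
    rcases Nat.lt_trichotomy i n with hlt | heq | hgt
    · have h1 := mul_le_mul_of_nonneg_left (hback i) (mul_pos (mul_pos hε hn1) hE0).le
      rw [pathGenerator, if_neg (by omega), if_pos (by omega)]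
      simp only [hAlow i hlt.le, hAlow (i + 1) hlt, hAlow (i - 1) (by omega), hBlow i hlt.le,
        hBlow (i + 1) hlt, hBlow (i - 1) (by omega)]
      rw [← mul_pow_sub_succ z (show i < 2 * n by omega)] at h1 ⊢
      set p := z ^ (2 * n - (i + 1))
      have h2 : k * (1 / n * (z * p)) * E = 1 / n * ((1 - z) * p * E) := by rw [← hk]; ring
      nlinarith
    · subst heq
      have h1 := mul_le_mul_of_nonneg_left (hback i) (mul_pos (mul_pos hε hn1) hE0).le
      rw [pathGenerator, if_pos rfl]
      simp only [hAlow i le_rfl, hAlow (i - 1) (by omega), hBlow i le_rfl,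
        hBlow (i - 1) (by omega), hAhigh (i + 1) (by omega) (by omega),
        hBhigh (i + 1) (by omega) (by omega), hAC, hBC]
      rw [← mul_pow_sub_succ z (show i < 2 * i by omega)] at h1 ⊢
      set p := z ^ (2 * i - (i + 1))
      have h2 : k * (1 / i * (z * p)) * E = 1 / i * ((1 - z) * p * E) := by rw [← hk]; ring
      nlinarith
    · rcases Nat.lt_or_ge i (2 * n) with hlt | hge
      · have h1 := mul_le_mul_of_nonneg_left (hcap (i - 1)) hε.le
        have h2 := mul_nonneg hε.le (hpos i)
        -- The power formula also dominates at `C`, where it reads `1 ≤ E`.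
        have h3 : A (i + 1) * E + B (i + 1) ≤ z ^ (2 * n - (i + 1)) * E := by
          rcases Nat.lt_or_ge (i + 1) (2 * n) with h | h
          · rw [hAhigh _ (by omega) h, hBhigh _ (by omega) h, add_zero]
          · rw [show i + 1 = 2 * n by omega, hAC, hBC, Nat.sub_self, pow_zero]
            linarith
        rw [pathGenerator, if_neg (by omega), if_pos hlt]
        have h4 : k * A i * E = z ^ (2 * n - (i + 1)) * E - (A i * E + B i) := by
          rw [hAhigh i hgt hlt, hBhigh i hgt hlt, ← mul_pow_sub_succ z hlt]
          linear_combination z ^ (2 * n - (i + 1)) * E * hk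
        nlinarith
      · have hi2 : i = 2 * n := le_antisymm hi hge
        subst hi2
        have h1 := mul_le_mul_of_nonneg_left (hcap (2 * n - 1)) hε.le
        have h2 := mul_le_mul_of_nonneg_left (hcap n) hε'.le
        rw [pathGenerator, if_neg (by omega), if_neg (by omega)]
        simp only [hAC, hBC]
        nlinarith
  have h := hbar.semigroup_le hn ht (fun i _ => add_nonneg (hA0 i) (hB0 i)) (by
    simp only [hA, hB]; rw [if_neg (by omega), if_neg (by omega), if_neg (by omega),
      if_neg (by omega)]; norm_num) 0
  refine h.trans (le_of_eq ?_)
  simp only [hA, hB, Fin.val_zero, Nat.zero_le, if_true, Nat.sub_zero]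
  ring

/-- Off `C`, following the path from `x` to `y` bounds the transition probability from below. -/
theorem le_semigroup_of_le (hn : 2 ≤ n) {t : ℝ} (ht : 0 ≤ t) {x y : Vertex n} (hxy : x.val ≤ y.val)
    (hy : y.val < 2 * n) :
    Real.exp (-2 * t) * (t / (2 * n ^ 2)) ^ (y.val - x.val) ≤ semigroup (rate n) t x y := by
  have hε := backRate_pos n
  have hε' := greenBackRate_pos hn
  have hn0 : 0 < (n : ℝ) := by positivity
  have hn1 : 0 < 1 / (n : ℝ) := by positivity
  have hn2 := one_sub_inv_pos hn
  have hε1 := backRate_le_one n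
  set m := y.val
  -- Subsolution: exit rates off `C` are at most `1 + backRate n ≤ 2`, and forward rates are at
  -- least `1/n`. Differentiating the power yields a factor at most `2n`, and `2n / (2n²) = 1/n` is
  -- what the forward jump supplies.
  set W : ℝ → ℕ → ℝ := fun s i => if i ≤ m then Real.exp (-2 * s) * (s / (2 * n ^ 2)) ^ (m - i) else 0
    with hW
  set W' : ℝ → ℕ → ℝ := fun s i => if i ≤ m then -2 * W s i
    + Real.exp (-2 * s) * (((m - i : ℕ) : ℝ) * (s / (2 * n ^ 2)) ^ (m - i - 1) * (1 / (2 * n ^ 2)))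
    else 0 with hW'
  rw [← semigroup_mulVec_single]
  have h := le_semigroup_mulVec_of_subsolution (rate_nonneg hn) ht
    (f := fun z => if z = y then 1 else 0) (w := fun s z => W s z.val)
    (w' := fun s z => W' s z.val) (fun z => ?_) (fun s z => ?_) (fun s hs _ z => ?_) x
  · simpa only [hW, if_pos hxy] using h
  · simp only [hW, mul_zero, Real.exp_zero, zero_div, one_mul]
    by_cases hzy : z = y
    · simp [hzy, m]
    · have : z.val ≠ m := fun h => hzy (Fin.ext h)
      rw [if_neg hzy]
      split_ifs with h
      · rw [zero_pow (by omega)]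
      · exact le_rfl
  · simp only [hW, hW']
    split_ifs with h
    · have h1 := ((hasDerivAt_id s).const_mul (-2)).exp.mul
        (((hasDerivAt_id s).div_const (2 * (n : ℝ) ^ 2)).pow (m - z.val))
      refine h1.congr_deriv ?_
      simp only [id_eq, mul_one, Pi.pow_apply]
      ring
    · exact hasDerivAt_const s 0
  · rw [generator_rate_mulVec_eq_pathGenerator hn]
    have hW0 : ∀ i, 0 ≤ W s i := fun i => by
      simp only [hW]; split_ifs <;> positivity
    have hz := z.isLt
    by_cases hzm : z.val ≤ m
    · have hzero : W s (2 * n) = 0 := by simp only [hW]; rw [if_neg (by omega)]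
      have hderiv : W' s z.val ≤ -2 * W s z.val + 1 / n * W s (z.val + 1) := by
        simp only [hW', if_pos hzm]
        refine add_le_add_right ?_ _
        rcases Nat.lt_or_ge z.val m with hlt | hge
        · have h1 : W s (z.val + 1) = Real.exp (-2 * s) * (s / (2 * n ^ 2)) ^ (m - z.val - 1) := by
            simp only [hW, if_pos (Nat.succ_le_of_lt hlt), Nat.sub_sub]
          have h2 : ((m - z.val : ℕ) : ℝ) * (1 / (2 * n ^ 2)) ≤ 1 / n := by
            have h3 : ((m - z.val : ℕ) : ℝ) ≤ 2 * n := by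
              exact_mod_cast (show m - z.val ≤ 2 * n by omega)
            calc ((m - z.val : ℕ) : ℝ) * (1 / (2 * n ^ 2)) ≤ 2 * n * (1 / (2 * n ^ 2)) :=
                  mul_le_mul_of_nonneg_right h3 (by positivity)
              _ = 1 / n := by field_simp
          rw [h1]
          have h4 := mul_le_mul_of_nonneg_right h2
            (by positivity : 0 ≤ Real.exp (-2 * s) * (s / (2 * n ^ 2)) ^ (m - z.val - 1))
          linarith
        · rw [Nat.sub_eq_zero_of_le hge]
          simpa using mul_nonneg hn1.le (hW0 (z.val + 1))
      refine hderiv.trans ?_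
      have h1 := hW0 z.val
      have h2 := mul_nonneg hε.le (hW0 (z.val - 1))
      have h3 := hW0 (z.val + 1)
      have h4 := mul_le_mul_of_nonneg_right hε1 h1
      have h5 := mul_nonneg hn2.le h3
      rw [pathGenerator]
      split_ifs with h h'
      · rw [h] at h1 h2 h3 h4 h5 ⊢
        rw [hzero]
        nlinarith
      · nlinarith
      · omega
    · have hzero : ∀ j, m < j → W s j = 0 := fun j hj => by simp only [hW]; rw [if_neg (by omega)]
      have h0 : W' s z.val = 0 := by simp only [hW', if_neg hzm]
      have h2 := mul_nonneg hε.le (hW0 (z.val - 1))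
      have h3 := mul_nonneg hε'.le (hW0 n)
      rw [h0, pathGenerator]
      split_ifs with h h'
      · rw [h] at hzm h2
        rw [hzero n (by omega), hzero (n + 1) (by omega), hzero (2 * n) (by omega)]
        linarith
      · rw [hzero z.val (by omega), hzero (z.val + 1) (by omega)]
        linarith
      · have hz2 : z.val = 2 * n := by omega
        rw [hz2] at h2
        rw [hzero (2 * n) (by omega)]
        linarith

end Barriers

/-! ### Asymptotics of the barriers -/

section Asymptotics

theorem exists_exp_lt {c : ℝ} (hc : c ≠ 0) {δ : ℝ} (hδ : 0 < δ) :
    ∃ h, 0 < h ∧ h < 1 / 2 ∧ Real.exp (c * h) < 1 + c * h + δ * h ∧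
      Real.exp (-(c * h)) < 1 - c * h + δ * h := by
  have hc2 : 0 < c ^ 2 := by positivity
  have hc' : 0 < |c| := abs_pos.2 hc
  obtain ⟨h, h0, h1⟩ : ∃ h, 0 < h ∧ h < min (1 / 2) (min (1 / |c|) (δ / c ^ 2)) :=
    exists_between (by positivity)
  obtain ⟨h2, h3⟩ := lt_min_iff.1 h1
  obtain ⟨h4, h5⟩ := lt_min_iff.1 h3
  rw [lt_div_iff₀ hc'] at h4
  rw [lt_div_iff₀ hc2] at h5
  have habs : |c * h| ≤ 1 := by rw [abs_mul, abs_of_pos h0]; linarith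
  have hsq : (c * h) ^ 2 < δ * h := by nlinarith
  refine ⟨h, h0, h2, ?_, ?_⟩
  · have := (abs_le.1 (Real.abs_exp_sub_one_sub_id_le habs)).2
    linarith
  · have := (abs_le.1 (Real.abs_exp_sub_one_sub_id_le (x := -(c * h)) (by rwa [abs_neg]))).2
    rw [neg_sq] at this
    linarith

/-- Chernoff tilt for unit exponential waiting times exceeding their mean. The drift inequality is
strict to leave room for the backward rates: `k` lies slightly below `h`, where `z = 1 / (1 - h)`.
-/
theorem exists_decay_of_one_lt {c : ℝ} (hc : 1 < c) :
    ∃ z k : ℝ, 1 < z ∧ 0 < k ∧ 1 - z + k * z < 0 ∧ z * Real.exp (-k * c) < 1 := by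
  obtain ⟨h, h0, h1, -, h3⟩ := exists_exp_lt (c := (1 + c) / 2) (by linarith : (1 + c) / 2 ≠ 0)
    (δ := (c - 1) / 2) (by linarith)
  have hz : 0 < 1 - h := by linarith
  have hc0 : 0 < c := by linarith
  refine ⟨1 / (1 - h), (1 + c) / 2 * h / c, ?_, by positivity, ?_, ?_⟩
  · rw [lt_div_iff₀ hz]; linarith
  · have : (1 + c) / 2 * h / c < h := by
      rw [div_lt_iff₀ hc0]; nlinarith
    have h4 : 1 - 1 / (1 - h) = -h * (1 / (1 - h)) := by field_simp; ring
    rw [h4, ← add_mul]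
    exact mul_neg_of_neg_of_pos (by linarith) (by positivity)
  · rw [neg_mul, div_mul_cancel₀ _ hc0.ne', one_div_mul_eq_div, div_lt_one hz]
    linarith

/-- The opposite tail: `z = 1 / (1 + k)` is the Laplace transform of a unit exponential time at `k`.
-/
theorem exists_decay_of_lt_one {c : ℝ} (hc0 : 0 < c) (hc : c < 1) :
    ∃ z k : ℝ, 0 < z ∧ z ≤ 1 ∧ 0 ≤ k ∧ k * z = 1 - z ∧ z * Real.exp (k * c) < 1 := by
  obtain ⟨h, h0, h1, h3, -⟩ := exists_exp_lt hc0.ne' (δ := 1 - c) (by linarith)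
  have hz : 0 < 1 + h := by linarith
  refine ⟨1 / (1 + h), h, by positivity, ?_, h0.le, ?_, ?_⟩
  · rw [div_le_one hz]; linarith
  · field_simp; ring
  · rw [one_div_mul_eq_div, div_lt_one hz, mul_comm h c]
    linarith

/-- `2^{-n²} Z^n = (Z 2^{-n})^n` is eventually at most `2^{-n}`, so backward rates beat any
exponential. -/
theorem tendsto_pow_mul_backRate (m : ℕ) (Z : ℝ) (hZ : 0 ≤ Z) :
    Tendsto (fun n : ℕ => (n : ℝ) ^ m * (backRate n * Z ^ n)) atTop (𝓝 0) := by
  have hgeo : Tendsto (fun n : ℕ => Z * (1 / 2 : ℝ) ^ n) atTop (𝓝 (Z * 0)) :=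
    (tendsto_pow_atTop_nhds_zero_of_lt_one (by norm_num) (by norm_num)).const_mul Z
  rw [mul_zero] at hgeo
  refine squeeze_zero' (Eventually.of_forall fun n => ?_) ?_
    (tendsto_pow_const_mul_const_pow_of_lt_one m (r := (1 / 2 : ℝ)) (by norm_num) (by norm_num))
  · have := backRate_pos n
    positivity
  · filter_upwards [hgeo.eventually_le_const (by norm_num : (0 : ℝ) < 1 / 2)] with n hn
    refine mul_le_mul_of_nonneg_left ?_ (by positivity)
    have : backRate n * Z ^ n = (Z * (1 / 2) ^ n) ^ n := by
      rw [mul_pow, ← pow_mul, ← pow_two, backRate, one_div_pow, mul_comm]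
    rw [this]
    exact pow_le_pow_left₀ (by positivity) hn n

theorem tendsto_backRate : Tendsto backRate atTop (𝓝 0) := by
  simpa using tendsto_pow_mul_backRate 0 1 zero_le_one

/-- The inner product has the form of the barrier error `η t` at `t` proportional to `n`; the outer
factor `n` shows that it is `o(1/n)`. -/
theorem tendsto_backRates_mul_pow (Z C : ℝ) (hZ : 0 ≤ Z) :
    Tendsto (fun n : ℕ => (n : ℝ) * (C * (backRate n + greenBackRate n) * Z ^ n * n)) atTop
      (𝓝 0) := by
  have h1 := ((tendsto_pow_mul_backRate 3 Z hZ).const_mul (2 * |C|))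
  rw [mul_zero] at h1
  refine squeeze_zero_norm' ?_ h1
  filter_upwards [eventually_ge_atTop 2] with n hn
  have hn' : (2 : ℝ) ≤ n := by exact_mod_cast hn
  have hε := backRate_pos n
  have hε' := greenBackRate_pos hn
  have h2 : greenBackRate n ≤ ((n : ℝ) - 1) * backRate n := by
    rw [greenBackRate_eq]
    exact mul_le_mul_of_nonneg_left
      (pow_le_of_le_one hε.le (backRate_le_one n) (by omega)) (by linarith)
  have h3 : backRate n + greenBackRate n ≤ 2 * (n * backRate n) := by nlinarith
  rw [Real.norm_eq_abs, abs_mul, abs_mul, abs_mul, abs_mul, abs_of_nonneg (by positivity : 0 ≤ (n : ℝ)),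
    abs_of_pos (add_pos hε hε'), abs_of_nonneg (pow_nonneg hZ n)]
  calc (n : ℝ) * (|C| * (backRate n + greenBackRate n) * Z ^ n * n)
      = (backRate n + greenBackRate n) * (n ^ 2 * |C| * Z ^ n) := by ring
    _ ≤ 2 * (n * backRate n) * (n ^ 2 * |C| * Z ^ n) :=
      mul_le_mul_of_nonneg_right h3 (by positivity)
    _ = 2 * |C| * (n ^ 3 * (backRate n * Z ^ n)) := by ring

theorem eventually_drift {z k : ℝ} (h : 1 - z + k * z < 0) :
    ∀ᶠ n : ℕ in atTop, 1 - z + backRate n * (z - 1) * z + k * z ≤ 0 := by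
  have h1 : Tendsto (fun n => 1 - z + backRate n * (z - 1) * z + k * z) atTop
      (𝓝 (1 - z + 0 * (z - 1) * z + k * z)) :=
    (((tendsto_backRate.mul_const _).mul_const _).const_add _).add_const _
  exact h1.eventually_le_const (by linarith)

/-! ### Transition probabilities at times proportional to `n`. -/

theorem exp_mul_mul_natCast (k c : ℝ) (n : ℕ) :
    Real.exp (k * (c * n)) = Real.exp (k * c) ^ n := by
  rw [← Real.exp_nat_mul]
  congr 1
  ring

theorem eventually_le_semigroup_of_one_lt {c : ℝ} (hc : 1 < c) :
    ∃ r : ℕ → ℝ, Tendsto r atTop (𝓝 0) ∧ ∀ᶠ n : ℕ in atTop, ∀ x,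
      1 - (1 + r n) / n ≤ semigroup (rate n) (c * n) x (vertexC n) := by
  obtain ⟨z, k, hz, hk0, hk, hzk⟩ := exists_decay_of_one_lt hc
  have hz0 : 0 < z := by linarith
  refine ⟨fun n => z * (n * (z * Real.exp (-k * c)) ^ n)
    + n * (2 * c * (backRate n + greenBackRate n) * (z ^ 2) ^ n * n), ?_, ?_⟩
  · have h1 := (tendsto_self_mul_const_pow_of_lt_one (r := z * Real.exp (-k * c)) (by positivity)
      hzk).const_mul z
    simpa using h1.add (tendsto_backRates_mul_pow (z ^ 2) (2 * c) (by positivity))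
  · filter_upwards [eventually_ge_atTop 2, eventually_drift hk] with n hn hd x
    have hn0 : (0 : ℝ) < n := by positivity
    have ht : 0 ≤ c * n := by positivity
    have heq : (1 + (z * (n * (z * Real.exp (-k * c)) ^ n)
        + n * (2 * c * (backRate n + greenBackRate n) * (z ^ 2) ^ n * n))) / n
        = 1 / n + z ^ (n + 1) * Real.exp (-k * (c * n))
          + 2 * (backRate n + greenBackRate n) * z ^ (2 * n) * (c * n) := by
      rw [exp_mul_mul_natCast, mul_pow, ← pow_mul, pow_succ]
      field_simp
      ring
    rw [heq]
    rcases le_or_gt x.val n with hx | hx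
    · have := one_sub_semigroup_le_of_le hn ht hz.le hk0.le hd hx
      linarith
    · have h1 := one_sub_semigroup_le_of_lt hn ht hz.le hk0.le hd hx
      have h2 := mul_le_mul_of_nonneg_right (pow_le_pow_right₀ hz.le (Nat.le_succ n))
        (Real.exp_pos (-k * (c * n))).le
      have h3 : 0 < 1 / (n : ℝ) := by positivity
      rw [Nat.succ_eq_add_one] at h2
      linarith

theorem eventually_le_semigroup_of_two_lt {c : ℝ} (hc : 2 < c) :
    ∃ r : ℕ → ℝ, Tendsto r atTop (𝓝 0) ∧ ∀ᶠ n : ℕ in atTop, ∀ x,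
      1 - r n / n ≤ semigroup (rate n) (c * n) x (vertexC n) := by
  -- The path has `2n` steps, so `cn` is `c/2` units of time per step; squaring gives the rate per
  -- unit of `n`.
  obtain ⟨z, k, hz, hk0, hk, hzk⟩ := exists_decay_of_one_lt (by linarith : 1 < c / 2)
  have hz0 : 0 < z := by linarith
  have hsq : (z * Real.exp (-k * (c / 2))) ^ 2 = z ^ 2 * Real.exp (-k * c) := by
    rw [mul_pow, ← Real.exp_nat_mul]
    congr 2
    push_cast
    ring
  have hlt : z ^ 2 * Real.exp (-k * c) < 1 := by
    rw [← hsq]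
    exact pow_lt_one₀ (by positivity) hzk (by norm_num)
  refine ⟨fun n => n * (z ^ 2 * Real.exp (-k * c)) ^ n
    + n * (c * (backRate n + greenBackRate n) * (z ^ 2) ^ n * n), ?_, ?_⟩
  · have h1 := tendsto_self_mul_const_pow_of_lt_one (r := z ^ 2 * Real.exp (-k * c)) (by positivity)
      hlt
    simpa using h1.add (tendsto_backRates_mul_pow (z ^ 2) c (by positivity))
  · filter_upwards [eventually_ge_atTop 2, eventually_drift hk] with n hn hd x
    have hn0 : (0 : ℝ) < n := by positivity
    have h := one_sub_semigroup_le_of_path hn (by positivity : 0 ≤ c * n) hz.le hk0.le hd x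
    have heq : (n * (z ^ 2 * Real.exp (-k * c)) ^ n
        + n * (c * (backRate n + greenBackRate n) * (z ^ 2) ^ n * n)) / n
        = z ^ (2 * n) * Real.exp (-k * (c * n))
          + (backRate n + greenBackRate n) * z ^ (2 * n) * (c * n) := by
      rw [exp_mul_mul_natCast, mul_pow, ← pow_mul]
      field_simp
    rw [heq]
    linarith

/-- Uniform in `t ≤ c n`, because a lower bound on a mixing time has to exclude every earlier time.
-/
theorem eventually_semigroup_le_of_lt_one {c : ℝ} (hc0 : 0 < c) (hc : c < 1) :
    ∃ r : ℕ → ℝ, Tendsto r atTop (𝓝 0) ∧ ∀ᶠ n : ℕ in atTop, ∀ t, 0 ≤ t → t ≤ c * n →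
      semigroup (rate n) t 0 (vertexC n) ≤ r n := by
  obtain ⟨z, k, hz0, hz1, hk0, hk, hzk⟩ := exists_decay_of_lt_one hc0 hc
  refine ⟨fun n => (z * Real.exp (k * c)) ^ n,
    tendsto_pow_atTop_nhds_zero_of_lt_one (by positivity) hzk, ?_⟩
  filter_upwards [eventually_ge_atTop 2] with n hn t ht htc
  refine (semigroup_zero_vertexC_le_exp hn ht hz0 hz1 hk).trans ?_
  rw [mul_pow, ← exp_mul_mul_natCast]
  exact mul_le_mul_of_nonneg_left (Real.exp_le_exp.2 (mul_le_mul_of_nonneg_left htc hk0))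
    (by positivity)

theorem eventually_semigroup_le_of_lt_two {c : ℝ} (hc0 : 0 < c) (hc : c < 2) :
    ∃ r : ℕ → ℝ, Tendsto r atTop (𝓝 0) ∧ ∀ᶠ n : ℕ in atTop, ∀ t, 0 ≤ t → t ≤ c * n →
      semigroup (rate n) t 0 (vertexC n) ≤ 1 - (1 - r n) / n := by
  obtain ⟨z, k, hz0, hz1, hk0, hk, hzk⟩ :=
    exists_decay_of_lt_one (by linarith : 0 < c / 2) (by linarith)
  have hsq : (z * Real.exp (k * (c / 2))) ^ 2 = z ^ 2 * Real.exp (k * c) := by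
    rw [mul_pow, ← Real.exp_nat_mul]
    congr 2
    push_cast
    ring
  have hlt : z ^ 2 * Real.exp (k * c) < 1 := by
    rw [← hsq]
    exact pow_lt_one₀ (by positivity) hzk (by norm_num)
  refine ⟨fun n => (z ^ 2 * Real.exp (k * c)) ^ n
    + n * (2 * c * (backRate n + greenBackRate n) * Real.exp (k * c) ^ n * n), ?_, ?_⟩
  · have h1 := tendsto_pow_atTop_nhds_zero_of_lt_one (r := z ^ 2 * Real.exp (k * c))
      (by positivity) hlt
    simpa using h1.add (tendsto_backRates_mul_pow (Real.exp (k * c)) (2 * c) (by positivity))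
  · filter_upwards [eventually_ge_atTop 2] with n hn t ht htc
    have hn0 : (0 : ℝ) < n := by positivity
    refine (semigroup_zero_vertexC_le hn ht htc hz0 hz1 hk).trans ?_
    have hε := backRate_pos n
    have hε' := greenBackRate_pos hn
    have h1 : Real.exp (k * t) ≤ Real.exp (k * (c * n)) :=
      Real.exp_le_exp.2 (mul_le_mul_of_nonneg_left htc hk0)
    have h2 := mul_le_mul_of_nonneg_left h1 (by positivity : 0 ≤ 1 / (n : ℝ) * z ^ (2 * n))
    have h3 := mul_le_mul_of_nonneg_left htc
      (by positivity : 0 ≤ 2 * (backRate n + greenBackRate n) * Real.exp (k * (c * n)))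
    have heq : 1 - (1 - ((z ^ 2 * Real.exp (k * c)) ^ n
        + n * (2 * c * (backRate n + greenBackRate n) * Real.exp (k * c) ^ n * n))) / n
        = 1 - 1 / n + 1 / n * z ^ (2 * n) * Real.exp (k * (c * n))
          + 2 * (backRate n + greenBackRate n) * Real.exp (k * (c * n)) * (c * n) := by
      rw [exp_mul_mul_natCast, mul_pow, ← pow_mul]
      field_simp
      ring
    rw [heq]
    linarith

/-- At most `2n` steps of weight of order `1/n`, times `e^{-2cn}`, still exceed `2^{-n²}`. -/
theorem eventually_backRate_le_semigroup {c : ℝ} (hc : 0 < c) :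
    ∀ᶠ n : ℕ in atTop, ∀ x y : Vertex n, x.val ≤ y.val → y.val < 2 * n →
      backRate n ≤ semigroup (rate n) (c * n) x y := by
  have h1 : Tendsto (fun n : ℕ => (n : ℝ) ^ 2 * (1 / 2 : ℝ) ^ n) atTop (𝓝 0) :=
    tendsto_pow_const_mul_const_pow_of_lt_one 2 (by norm_num) (by norm_num)
  have h2 : Tendsto (fun n : ℕ => c / 2 / (n : ℝ)) atTop (𝓝 0) :=
    tendsto_const_nhds.div_atTop tendsto_natCast_atTop_atTop
  filter_upwards [eventually_ge_atTop 2,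
    h1.eventually_le_const (by positivity : 0 < Real.exp (-2 * c) * (c / 2) ^ 2),
    h2.eventually_le_const one_pos] with n hn hA hB x y hxy hy
  have hn0 : (0 : ℝ) < n := by positivity
  refine le_trans ?_ (le_semigroup_of_le hn (by positivity : 0 ≤ c * n) hxy hy)
  have heq : c * n / (2 * n ^ 2) = c / 2 / (n : ℝ) := by field_simp
  rw [heq, exp_mul_mul_natCast]
  calc backRate n = ((1 / 2 : ℝ) ^ n) ^ n := by rw [backRate, ← pow_mul, one_div_pow, pow_two]
    _ ≤ (Real.exp (-2 * c) * (c / 2 / n) ^ 2) ^ n := by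
      refine pow_le_pow_left₀ (by positivity) ?_ n
      rw [div_pow (c / 2), ← mul_div_assoc, le_div_iff₀ (by positivity)]
      linarith
    _ = Real.exp (-2 * c) ^ n * (c / 2 / n) ^ (2 * n) := by rw [mul_pow, ← pow_mul]
    _ ≤ Real.exp (-2 * c) ^ n * (c / 2 / n) ^ (y.val - x.val) :=
      mul_le_mul_of_nonneg_left (pow_le_pow_of_le_one (by positivity) hB (by omega))
        (by positivity)

end Asymptotics

/-! ### Mixing times -/

section Mixing

theorem tendsto_mixingTime_div {d : ℕ → ℝ → ℝ} {a L : ℝ} (hL : 0 < L)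
    (hlow : ∀ c, 0 < c → c < L → ∀ᶠ n : ℕ in atTop, ∀ t, 0 ≤ t → t ≤ c * n → a ≤ d n t)
    (hup : ∀ c, L < c → ∀ᶠ n : ℕ in atTop, d n (c * n) < a) :
    Tendsto (fun n : ℕ => mixingTime (d n) a / n) atTop (𝓝 L) := by
  have hupper : ∀ c, L < c → ∀ᶠ n : ℕ in atTop, mixingTime (d n) a / n ≤ c := by
    intro c hc
    filter_upwards [hup c hc, eventually_gt_atTop 0] with n hn hn0
    have hn' : (0 : ℝ) < n := by exact_mod_cast hn0
    have hc0 : 0 < c := hL.trans hc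
    rw [div_le_iff₀ hn']
    exact csInf_le ⟨0, fun t ht => ht.1⟩ ⟨by positivity, hn⟩
  have hlower : ∀ c, 0 < c → c < L → ∀ᶠ n : ℕ in atTop, c ≤ mixingTime (d n) a / n := by
    intro c hc0 hc
    filter_upwards [hlow c hc0 hc, hup (L + 1) (by linarith), eventually_gt_atTop 0]
      with n hn hn1 hn0
    have hn' : (0 : ℝ) < n := by exact_mod_cast hn0
    rw [le_div_iff₀ hn']
    -- Nonemptiness matters: the infimum of the empty set would be `0`.
    refine le_csInf ⟨(L + 1) * n, by positivity, hn1⟩ fun t ht => ?_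
    by_contra! hlt
    exact (hn t ht.1 hlt.le).not_gt ht.2
  refine tendsto_order.2 ⟨fun b hb => ?_, fun b hb => ?_⟩
  · obtain ⟨c, hc1, hc2⟩ := exists_between (max_lt hb hL)
    obtain ⟨hc3, hc4⟩ := max_lt_iff.1 hc1
    filter_upwards [hlower c hc4 hc2] with n hn using hc3.trans_le hn
  · obtain ⟨c, hc1, hc2⟩ := exists_between hb
    filter_upwards [hupper c hc1] with n hn using hn.trans_lt hc2

theorem tendsto_div_of_tendsto_div_natCast {f g : ℕ → ℝ} {a b : ℝ} (hb : b ≠ 0)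
    (hf : Tendsto (fun n : ℕ => f n / n) atTop (𝓝 a))
    (hg : Tendsto (fun n : ℕ => g n / n) atTop (𝓝 b)) :
    Tendsto (fun n => f n / g n) atTop (𝓝 (a / b)) := by
  refine (hf.div hg hb).congr' ?_
  filter_upwards [eventually_gt_atTop 0] with n hn
  have hn' : (n : ℝ) ≠ 0 := by exact_mod_cast hn.ne'
  simp only [Pi.div_apply]
  exact div_div_div_cancel_right₀ hn' _ _

/-- The total-variation distance is at most the separation distance, so that a lower bound on the
former and an upper bound on the latter locate both mixing times. -/
theorem tendsto_mixingTime_div_of_le {d ds : ℕ → ℝ → ℝ} {a L : ℝ} (hL : 0 < L)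
    (hle : ∀ᶠ n : ℕ in atTop, ∀ t, 0 ≤ t → d n t ≤ ds n t)
    (hlow : ∀ c, 0 < c → c < L → ∀ᶠ n : ℕ in atTop, ∀ t, 0 ≤ t → t ≤ c * n → a ≤ d n t)
    (hup : ∀ c, L < c → ∀ᶠ n : ℕ in atTop, ds n (c * n) < a) :
    Tendsto (fun n : ℕ => mixingTime (d n) a / n) atTop (𝓝 L) ∧
      Tendsto (fun n : ℕ => mixingTime (ds n) a / n) atTop (𝓝 L) := by
  refine ⟨tendsto_mixingTime_div hL hlow fun c hc => ?_,
    tendsto_mixingTime_div hL (fun c hc0 hc => ?_) hup⟩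
  · filter_upwards [hle, hup c hc] with n h1 h2
    exact (h1 _ (mul_nonneg (hL.trans hc).le n.cast_nonneg)).trans_lt h2
  · filter_upwards [hle, hlow c hc0 hc] with n h1 h2 t ht htc
    exact (h2 t ht htc).trans (h1 t ht)

variable {π : (n : ℕ) → Vertex n → ℝ}

/-- Only the column of `C` matters for separation. The ratio is symmetric in `x` and `y` by
reversibility, so one may take `x` before `y`; if `y ≠ C` it is then at least `1 ≥ m`. -/
theorem eventually_le_semigroup_div (hπ : ∀ n : ℕ, 2 ≤ n → IsReversibleProb (rate n) (π n))
    {c : ℝ} (hc : 0 < c) :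
    ∀ᶠ n : ℕ in atTop, ∀ m : ℝ, (∀ x, m ≤ semigroup (rate n) (c * n) x (vertexC n)) →
      ∀ x y, m ≤ semigroup (rate n) (c * n) x y / π n y := by
  filter_upwards [eventually_ge_atTop 2, eventually_backRate_le_semigroup hc]
    with n hn hback m hm
  have hrev := hπ n hn
  have hpos := hrev.pos (rate_isIrreducible hn)
  have ht : 0 ≤ c * n := by positivity
  have hP0 := semigroup_nonneg (rate_nonneg hn) ht
  have hP1 : ∀ x y, semigroup (rate n) (c * n) x y ≤ 1 := fun x y => by
    rw [← sum_semigroup (rate_nonneg hn) ht x]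
    exact Finset.single_le_sum (fun z _ => hP0 x z) (Finset.mem_univ y)
  have hm1 : m ≤ 1 := (hm (vertexC n)).trans (hP1 _ _)
  have hswap : ∀ x y, semigroup (rate n) (c * n) x y / π n y
      = semigroup (rate n) (c * n) y x / π n x := fun x y => by
    rw [div_eq_div_iff (hpos y).ne' (hpos x).ne']
    linarith [semigroup_reversible hpos hrev.2.2 (c * n) x y]
  have hC : ∀ x, m ≤ semigroup (rate n) (c * n) x (vertexC n) / π n (vertexC n) := fun x => by
    refine (hm x).trans ?_
    rw [le_div_iff₀ (hpos _)]
    refine mul_le_of_le_one_right (hP0 _ _) ?_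
    rw [← hrev.2.1]
    exact Finset.single_le_sum (fun z _ => hrev.1 z) (Finset.mem_univ _)
  have hmain : ∀ x y : Vertex n, x.val ≤ y.val →
      m ≤ semigroup (rate n) (c * n) x y / π n y := by
    intro x y hxy
    by_cases hy : y = vertexC n
    · rw [hy]; exact hC x
    · have hlt : y.val < 2 * n := by
        have := mt (eq_vertexC_iff y).2 hy
        have := y.isLt
        omega
      refine hm1.trans ?_
      rw [le_div_iff₀ (hpos y), one_mul]
      exact (hrev.le_backRate hn hlt).trans (hback x y hxy hlt)
  intro x y
  rcases le_total x.val y.val with h | h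
  · exact hmain x y h
  · rw [hswap]; exact hmain y x h

theorem eventually_tvDist_le_sepDist (hπ : ∀ n : ℕ, 2 ≤ n → IsReversibleProb (rate n) (π n)) :
    ∀ᶠ n : ℕ in atTop, ∀ t, 0 ≤ t →
      tvDist (semigroup (rate n)) (π n) t ≤ sepDist (semigroup (rate n)) (π n) t ∧
      tvDist (prodSemigroup n (semigroup (rate n))) (prodMeasure n (π n)) t
        ≤ sepDist (prodSemigroup n (semigroup (rate n))) (prodMeasure n (π n)) t := by
  filter_upwards [eventually_ge_atTop 2] with n hn t ht
  have hrev := hπ n hn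
  have hpos := hrev.pos (rate_isIrreducible hn)
  have hP1 := sum_semigroup (rate_nonneg hn) ht
  exact ⟨tvDist_le_sepDist hpos hrev.2.1 hP1, tvDist_le_sepDist (prodMeasure_pos n hpos)
    (sum_prodMeasure n hrev.2.1) (sum_prodSemigroup n hP1)⟩

/-! ### Equilibrium mass at `C` and limits of `n`-th powers. -/

theorem tendsto_vertexC (hπ : ∀ n : ℕ, 2 ≤ n → IsReversibleProb (rate n) (π n)) :
    Tendsto (fun n => π n (vertexC n)) atTop (𝓝 1) := by
  have h1 := ((tendsto_pow_mul_backRate 1 1 zero_le_one).const_mul 2).const_sub 1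
  simp only [pow_one, one_pow, mul_one, mul_zero, sub_zero] at h1
  refine tendsto_of_tendsto_of_tendsto_of_le_of_le' h1 tendsto_const_nhds ?_ ?_
  · filter_upwards [eventually_ge_atTop 2] with n hn
    have := (hπ n hn).one_sub_le_vertexC hn
    linarith
  · filter_upwards [eventually_ge_atTop 2] with n hn
    rw [← (hπ n hn).2.1]
    exact Finset.single_le_sum (fun z _ => (hπ n hn).1 z) (Finset.mem_univ _)

theorem tendsto_vertexC_pow (hπ : ∀ n : ℕ, 2 ≤ n → IsReversibleProb (rate n) (π n)) :
    Tendsto (fun n => π n (vertexC n) ^ n) atTop (𝓝 1) := by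
  have h1 := (tendsto_pow_mul_backRate 2 1 zero_le_one).const_mul (-2)
  simp only [one_pow, mul_one, mul_zero] at h1
  have h2 : Tendsto (fun n : ℕ => (1 + -2 * (n * backRate n)) ^ n) atTop
      (𝓝 (Real.exp 0)) := by
    refine Real.tendsto_one_add_pow_exp_of_tendsto (h1.congr fun n => ?_)
    ring
  rw [Real.exp_zero] at h2
  have h3 := (tendsto_pow_mul_backRate 1 1 zero_le_one).const_mul 2
  simp only [pow_one, one_pow, mul_one, mul_zero] at h3
  refine tendsto_of_tendsto_of_tendsto_of_le_of_le' h2 tendsto_const_nhds ?_ ?_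
  · filter_upwards [eventually_ge_atTop 2, h3.eventually_le_const one_pos] with n hn hle
    refine pow_le_pow_left₀ (by linarith) ?_ n
    have := (hπ n hn).one_sub_le_vertexC hn
    linarith
  · filter_upwards [eventually_ge_atTop 2] with n hn
    refine pow_le_one₀ ((hπ n hn).1 _) ?_
    rw [← (hπ n hn).2.1]
    exact Finset.single_le_sum (fun z _ => (hπ n hn).1 z) (Finset.mem_univ _)

theorem tendsto_one_sub_div_pow {r : ℕ → ℝ} {l : ℝ} (hr : Tendsto r atTop (𝓝 l)) :
    Tendsto (fun n : ℕ => (1 - r n / n) ^ n) atTop (𝓝 (Real.exp (-l))) := by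
  have h : Tendsto (fun n : ℕ => (1 + -(r n / n)) ^ n) atTop (𝓝 (Real.exp (-l))) := by
    refine Real.tendsto_one_add_pow_exp_of_tendsto (hr.neg.congr' ?_)
    filter_upwards [eventually_gt_atTop 0] with n hn
    have hn' : (n : ℝ) ≠ 0 := by exact_mod_cast hn.ne'
    field_simp
  simpa only [← sub_eq_add_neg] using h

theorem tendsto_one_sub_div {r : ℕ → ℝ} {l : ℝ} (hr : Tendsto r atTop (𝓝 l)) :
    Tendsto (fun n : ℕ => 1 - r n / n) atTop (𝓝 1) := by
  simpa using (hr.div_atTop tendsto_natCast_atTop_atTop).const_sub 1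

/-- If `P_{cn}(x, C) ≥ 1 - r n / n` for all `x`, the separation distances are small. -/
theorem tendsto_sepDist_bounds (hπ : ∀ n : ℕ, 2 ≤ n → IsReversibleProb (rate n) (π n))
    {c l : ℝ} (hc : 0 < c) {r : ℕ → ℝ} (hr : Tendsto r atTop (𝓝 l))
    (hP : ∀ᶠ n : ℕ in atTop, ∀ x, 1 - r n / n ≤ semigroup (rate n) (c * n) x (vertexC n))
    {a : ℝ} :
    (0 < a → ∀ᶠ n : ℕ in atTop, sepDist (semigroup (rate n)) (π n) (c * n) < a) ∧
    (1 - Real.exp (-l) < a → ∀ᶠ n : ℕ in atTop,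
      sepDist (prodSemigroup n (semigroup (rate n))) (prodMeasure n (π n)) (c * n) < a) := by
  have h1 := tendsto_one_sub_div hr
  refine ⟨fun ha => ?_, fun ha => ?_⟩
  · filter_upwards [eventually_le_semigroup_div hπ hc, hP,
      h1.eventually_const_lt (by linarith : 1 - a < 1)] with n h2 h3 h4
    have := sepDist_le (h2 _ h3)
    linarith
  · filter_upwards [eventually_le_semigroup_div hπ hc, hP,
      h1.eventually_const_le (by norm_num : (0 : ℝ) < 1),
      (tendsto_one_sub_div_pow hr).eventually_const_lt (by linarith : 1 - a < Real.exp (-l))]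
      with n h2 h3 h4 h5
    have := sepDist_prod_le n h4 (h2 _ h3)
    linarith

/-! ### Limits of the mixing times. -/

theorem tendsto_tMix_tSep (hπ : ∀ n : ℕ, 2 ≤ n → IsReversibleProb (rate n) (π n)) {a : ℝ}
    (ha0 : 0 < a) (ha1 : a < 1) :
    Tendsto (fun n : ℕ => tMix π n a / n) atTop (𝓝 1) ∧
      Tendsto (fun n : ℕ => tSep π n a / n) atTop (𝓝 1) := by
  refine tendsto_mixingTime_div_of_le
    (d := fun n => tvDist (semigroup (rate n)) (π n))
    (ds := fun n => sepDist (semigroup (rate n)) (π n)) one_pos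
    ((eventually_tvDist_le_sepDist hπ).mono fun n h t ht => (h t ht).1) ?_ ?_
  · intro c hc0 hc
    obtain ⟨r, hr, hP⟩ := eventually_semigroup_le_of_lt_one hc0 hc
    have h1 := (tendsto_vertexC hπ).sub hr
    rw [sub_zero] at h1
    filter_upwards [hP, h1.eventually_const_le ha1, eventually_ge_atTop 2] with n h2 h3 hn t ht htc
    have h4 := sub_le_tvDist (hπ n hn).2.1 (sum_semigroup (rate_nonneg hn) ht) 0 (vertexC n)
    linarith [h2 t ht htc]
  · intro c hc
    obtain ⟨r, hr, hP⟩ := eventually_le_semigroup_of_one_lt hc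
    exact (tendsto_sepDist_bounds hπ (by linarith) (hr.const_add 1) hP).1 ha0

theorem tendsto_TMix_TSep_two (hπ : ∀ n : ℕ, 2 ≤ n → IsReversibleProb (rate n) (π n)) {a : ℝ}
    (ha0 : 0 < a) (ha1 : a < 1 - Real.exp (-1)) :
    Tendsto (fun n : ℕ => TMix π n a / n) atTop (𝓝 2) ∧
      Tendsto (fun n : ℕ => TSep π n a / n) atTop (𝓝 2) := by
  refine tendsto_mixingTime_div_of_le
    (d := fun n => tvDist (prodSemigroup n (semigroup (rate n))) (prodMeasure n (π n)))
    (ds := fun n => sepDist (prodSemigroup n (semigroup (rate n))) (prodMeasure n (π n))) two_pos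
    ((eventually_tvDist_le_sepDist hπ).mono fun n h t ht => (h t ht).2) ?_ ?_
  · intro c hc0 hc
    obtain ⟨r, hr, hP⟩ := eventually_semigroup_le_of_lt_two hc0 hc
    have hr1 := hr.const_sub 1
    rw [sub_zero] at hr1
    -- The limit is `1 - e⁻¹`: some copy takes the long route with about this probability.
    have h1 := (tendsto_vertexC_pow hπ).sub (tendsto_one_sub_div_pow hr1)
    filter_upwards [hP, h1.eventually_const_le ha1, eventually_ge_atTop 2] with n h2 h3 hn t ht htc
    have h4 := pow_sub_pow_le_tvDist_prod n (hπ n hn).2.1 (sum_semigroup (rate_nonneg hn) ht) 0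
      (vertexC n)
    have h5 := pow_le_pow_left₀ (semigroup_nonneg (rate_nonneg hn) ht 0 (vertexC n)) (h2 t ht htc) n
    linarith
  · intro c hc
    obtain ⟨r, hr, hP⟩ := eventually_le_semigroup_of_two_lt hc
    exact (tendsto_sepDist_bounds hπ (by linarith) hr hP).2 (by simpa using ha0)

theorem tendsto_TMix_TSep_one (hπ : ∀ n : ℕ, 2 ≤ n → IsReversibleProb (rate n) (π n)) {a : ℝ}
    (ha0 : 1 - Real.exp (-1) < a) (ha1 : a < 1) :
    Tendsto (fun n : ℕ => TMix π n a / n) atTop (𝓝 1) ∧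
      Tendsto (fun n : ℕ => TSep π n a / n) atTop (𝓝 1) := by
  refine tendsto_mixingTime_div_of_le
    (d := fun n => tvDist (prodSemigroup n (semigroup (rate n))) (prodMeasure n (π n)))
    (ds := fun n => sepDist (prodSemigroup n (semigroup (rate n))) (prodMeasure n (π n))) one_pos
    ((eventually_tvDist_le_sepDist hπ).mono fun n h t ht => (h t ht).2) ?_ ?_
  · intro c hc0 hc
    obtain ⟨r, hr, hP⟩ := eventually_semigroup_le_of_lt_one hc0 hc
    have h1 := (tendsto_vertexC_pow hπ).sub hr
    rw [sub_zero] at h1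
    filter_upwards [hP, h1.eventually_const_le ha1, hr.eventually_le_const one_pos,
      eventually_ge_atTop 2] with n h2 h3 hr1 hn t ht htc
    have h4 := pow_sub_pow_le_tvDist_prod n (hπ n hn).2.1 (sum_semigroup (rate_nonneg hn) ht) 0
      (vertexC n)
    -- Before time `n` one factor is already small, so the crude bound `P ^ n ≤ P` is enough.
    have h5 := pow_le_of_le_one (semigroup_nonneg (rate_nonneg hn) ht 0 (vertexC n))
      ((h2 t ht htc).trans hr1) (by omega : n ≠ 0)
    linarith [h2 t ht htc]
  · intro c hc
    obtain ⟨r, hr, hP⟩ := eventually_le_semigroup_of_one_lt hc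
    exact (tendsto_sepDist_bounds hπ (by linarith) (hr.const_add 1) hP).2 (by simpa using ha0)

/-! ### From limits of mixing times to cutoff or its failure. -/

theorem exp_neg_one_lt_half : Real.exp (-1) < 1 / 2 := by
  rw [Real.exp_neg, inv_lt_comm₀ (Real.exp_pos 1) (by norm_num)]
  have := Real.exp_one_gt_d9
  norm_num at this ⊢
  linarith

theorem hasCutoff_of_tendsto_div_natCast {T : ℕ → ℝ → ℝ} {L : ℝ} (hL : L ≠ 0)
    (hT : ∀ a : ℝ, 0 < a → a < 1 → Tendsto (fun n : ℕ => T n a / (n : ℝ)) atTop (𝓝 L)) :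
    HasCutoff T := by
  intro ε h0 h1
  have h := tendsto_div_of_tendsto_div_natCast hL (hT ε h0 (by linarith))
    (hT (1 - ε) (by linarith) (by linarith))
  rwa [div_self hL] at h

theorem tendsto_ratio_two {T : ℕ → ℝ → ℝ}
    (h2 : ∀ a : ℝ, 0 < a → a < 1 - Real.exp (-1) →
      Tendsto (fun n : ℕ => T n a / (n : ℝ)) atTop (𝓝 2))
    (h1 : ∀ a : ℝ, 1 - Real.exp (-1) < a → a < 1 →
      Tendsto (fun n : ℕ => T n a / (n : ℝ)) atTop (𝓝 1)) {ε : ℝ} (hε0 : 0 < ε)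
    (hε : ε < Real.exp (-1)) : Tendsto (fun n : ℕ => T n ε / T n (1 - ε)) atTop (𝓝 2) := by
  -- `e⁻¹ < 1/2` gives `ε < e⁻¹ < 1 - e⁻¹ < 1 - ε`, so the two levels lie on opposite sides of the
  -- threshold.
  have he := exp_neg_one_lt_half
  have h := tendsto_div_of_tendsto_div_natCast one_ne_zero (h2 ε hε0 (by linarith))
    (h1 (1 - ε) (by linarith) (by linarith))
  rwa [div_one] at h

theorem not_hasCutoff_of_tendsto_ratio {T : ℕ → ℝ → ℝ}
    (h : ∀ ε : ℝ, 0 < ε → ε < Real.exp (-1) →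
      Tendsto (fun n : ℕ => T n ε / T n (1 - ε)) atTop (𝓝 2)) : ¬ HasCutoff T := by
  intro hcut
  have he := exp_neg_one_lt_half
  have he0 := Real.exp_pos (-1)
  have h1 := hcut (Real.exp (-1) / 2) (by linarith) (by linarith)
  have h2 := h (Real.exp (-1) / 2) (by linarith) (by linarith)
  have := tendsto_nhds_unique h1 h2
  norm_num at this

end Mixing

end ProductCutoff

open ProductCutoff in
theorem proposition3p1 :
    -- for `n ≥ 2`, `X^n` is an irreducible chain with a unique reversible probability
    (∀ n : ℕ, 2 ≤ n →
      (∀ x y : Vertex n, 0 ≤ rate n x y) ∧ IsIrreducible (rate n) ∧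
        ∃! π : Vertex n → ℝ, IsReversibleProb (rate n) π) ∧
    ∀ π : (n : ℕ) → Vertex n → ℝ, (∀ n : ℕ, 2 ≤ n → IsReversibleProb (rate n) (π n)) →
      -- (i) cutoff of `X^n` around time `n`
      (∀ T ∈ ({tMix π, tSep π} : Set (ℕ → ℝ → ℝ)),
        HasCutoff T ∧
        ∀ a : ℝ, 0 < a → a < 1 → Tendsto (fun n : ℕ => T n a / (n : ℝ)) atTop (𝓝 1)) ∧
      -- (ii) no cutoff for `Y^n`
      (∀ T ∈ ({TMix π, TSep π} : Set (ℕ → ℝ → ℝ)),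
        ¬ HasCutoff T ∧
        (∀ a : ℝ, 0 < a → a < 1 - Real.exp (-1) →
          Tendsto (fun n : ℕ => T n a / (n : ℝ)) atTop (𝓝 2)) ∧
        (∀ a : ℝ, 1 - Real.exp (-1) < a → a < 1 →
          Tendsto (fun n : ℕ => T n a / (n : ℝ)) atTop (𝓝 1)) ∧
        -- the ratio of mixing times attains the value `2`
        ∀ ε : ℝ, 0 < ε → ε < Real.exp (-1) →
          Tendsto (fun n : ℕ => T n ε / T n (1 - ε)) atTop (𝓝 2)) := by
  refine ⟨fun n hn => ⟨rate_nonneg hn, rate_isIrreducible hn, existsUnique_isReversibleProb hn⟩,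
    fun π hπ => ⟨fun T hT => ?_, fun T hT => ?_⟩⟩
  · have hlim : ∀ a : ℝ, 0 < a → a < 1 → Tendsto (fun n : ℕ => T n a / (n : ℝ)) atTop (𝓝 1) := by
      intro a h0 h1
      rcases hT with rfl | rfl
      · exact (tendsto_tMix_tSep hπ h0 h1).1
      · exact (tendsto_tMix_tSep hπ h0 h1).2
    exact ⟨hasCutoff_of_tendsto_div_natCast one_ne_zero hlim, hlim⟩
  · have htwo : ∀ a : ℝ, 0 < a → a < 1 - Real.exp (-1) →
        Tendsto (fun n : ℕ => T n a / (n : ℝ)) atTop (𝓝 2) := by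
      intro a h0 h1
      rcases hT with rfl | rfl
      · exact (tendsto_TMix_TSep_two hπ h0 h1).1
      · exact (tendsto_TMix_TSep_two hπ h0 h1).2
    have hone : ∀ a : ℝ, 1 - Real.exp (-1) < a → a < 1 →
        Tendsto (fun n : ℕ => T n a / (n : ℝ)) atTop (𝓝 1) := by
      intro a h0 h1
      rcases hT with rfl | rfl
      · exact (tendsto_TMix_TSep_one hπ h0 h1).1
      · exact (tendsto_TMix_TSep_one hπ h0 h1).2
    have hratio := fun ε h0 h1 => tendsto_ratio_two htwo hone (ε := ε) h0 h1
    exact ⟨not_hasCutoff_of_tendsto_ratio hratio, htwo, hone, hratio⟩
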